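/- Let $q\ge 1$, let $S,F$ be real $q\times q$ matrices with $S$ and $V=S-FSF'$ positive definite, and let $n>0$ be real. Let $IW_m(d,D)$ be the inverse Wishart law on positive definite $m\times m$ matrices with density proportional to $|\Sigma|^{-(d/2+m)}\exp\{-\tfrac12\mathrm{tr}(D\Sigma^{-1})\}$. Let $(\Sigma_t)_{t\ge 0}$ be the stationary Markov process of $q\times q$ matrices for which, for every $t\ge1$, $(\Sigma_{t-1},\Sigma_t)$ is distributed as the pair of diagonal blocks of $$\begin{pmatrix}\Sigma_{t-1}&\phi_t'\\ \phi_t&\Sigma_t\end{pmatrix}\sim IW_{2q}\left(n+2,\;n\begin{pmatrix}S&SF'\\FS&S\end{pmatrix}\right),$$ and let $E[\Sigma_t\mid\Sigma_0]$ be the version of the conditional expectation obtained by iterating the transition density $p(\Sigma_t\mid\Sigma_{t-1})$ that is the ratio of the resulting joint density of $(\Sigma_{t-1},\Sigma_t)$ and its marginal; it is defined for every positive definite value of $\Sigma_0$ (in particular, all these means are finite). Write $c_{n,q}=n/(n+q)$ and $\|A\|_\infty=\max_i\sum_j|A_{ij}|$. (i) For every $t\ge 0$ and $\lambda\in\mathbb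 R$ there is a constant $C=C(q,t,\lambda)$ such that, whenever $\|S\|_\infty,\|S^{-1}\|_\infty,\|F\|_\infty\le\lambda$, for all $n>0$ and all positive definite $\Sigma_0$, $$E[\Sigma_t\mid\Sigma_0]=F^t\Sigma_0F'^t+c_{n,q}\,(S-F^tSF'^t)+R,\qquad |R_{ij}|\le \frac{C\,(1+\|\Sigma_0\|_\infty)}{n}\quad(1\le i,j\le q).$$ (ii) For fixed $S$, $F$, $t$ and positive definite $\Sigma_0$, $$\lim_{n\to\infty}E[\Sigma_t\mid\Sigma_0]=S+F^t(\Sigma_0-S)F'^t.$$ (iii) If the spectral radius $\rho(F)$ is below $1$, then for every $r>\rho(F)$ there is a constant $K$ (depending on $q,S,F,r$) such that for all $t\ge0$ and all positive definite $\Sigma_0$, $$\Big\|\lim_{n\to\infty}E[\Sigma_t\mid\Sigma_0]-S\Big\|_\infty\le K\,r^{2t}\,\|\Sigma_0-S\|_\infty .$$ -/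

import Mathlib

open MeasureTheory ProbabilityTheory Filter Topology
open scoped ENNReal

noncomputable section

namespace IWAR

/-- Borel sigma-algebra on matrices: generated by the entries. -/
instance {ι : Type*} : MeasurableSpace (Matrix ι ι ℝ) :=
  inferInstanceAs (MeasurableSpace (ι → ι → ℝ))

/-- The symmetric matrix whose entry at `(i, j)`, and at `(j, i)`, is `z s(i, j)`. -/
def symMat {ι : Type*} (z : Sym2 ι → ℝ) : Matrix ι ι ℝ := Matrix.of fun i j => z s(i, j)

variable {ι : Type*} [Fintype ι] [DecidableEq ι]

/-- Lebesgue measure on the space of symmetric matrices (the product of the Lebesgue measures of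
the entries, one for each unordered pair of indices), seen as a measure on all square matrices. -/
def symLebesgue (ι : Type*) [Fintype ι] [DecidableEq ι] : Measure (Matrix ι ι ℝ) :=
  (volume : Measure (Sym2 ι → ℝ)).map symMat

open Classical in
/-- The function `|Σ| ^ (-(d/2 + q)) exp(-tr(D Σ⁻¹)/2)` on the positive definite `q × q` matrices
`Σ`, and `0` elsewhere: the inverse Wishart density before normalization. -/
def invWishartKernel (d : ℝ) (D : Matrix ι ι ℝ) (M : Matrix ι ι ℝ) : ℝ≥0∞ :=
  if M.PosDef then
    ENNReal.ofReal (M.det ^ (-(d / 2 + (Fintype.card ι : ℝ))) *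
      Real.exp (-(Matrix.trace (D * M⁻¹)) / 2))
  else 0

/-- The density of the inverse Wishart distribution `IW_q(d, D)` with respect to Lebesgue measure
on symmetric matrices. The degrees of freedom are parametrized so that the mean is `D / (d - 2)`
for `d > 2`, and `IW_1(d, D)` is the inverse gamma distribution `IG(d/2, D/2)`. -/
def invWishartPDF (d : ℝ) (D : Matrix ι ι ℝ) (M : Matrix ι ι ℝ) : ℝ≥0∞ :=
  invWishartKernel d D M / ∫⁻ N, invWishartKernel d D N ∂(symLebesgue ι)

/-- The inverse Wishart distribution `IW_q(d, D)`. -/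
def invWishart (d : ℝ) (D : Matrix ι ι ℝ) : Measure (Matrix ι ι ℝ) :=
  (symLebesgue ι).withDensity (invWishartPDF d D)

/-- The scale matrix `n [S, S F'; F S, S]` of the augmented `2q × 2q` inverse Wishart law. -/
def augScale (n : ℝ) (S F : Matrix ι ι ℝ) : Matrix (ι ⊕ ι) (ι ⊕ ι) ℝ :=
  n • Matrix.fromBlocks S (S * F.transpose) (F * S) S

/-- The process `X = (Σ_t)` is an inverse Wishart autoregressive process of order one with
parameters `n, S, F`: it is a Markov process, and two consecutive states are jointly distributed
as the diagonal blocks of `[Σ_{t-1}, φ'; φ, Σ_t] ∼ IW_{2q}(n + 2, n [S, S F'; F S, S])`. -/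
structure IsIWAR {Ω : Type*} [MeasurableSpace Ω] (P : Measure Ω) (n : ℝ) (S F : Matrix ι ι ℝ)
    (X : ℕ → Ω → Matrix ι ι ℝ) : Prop where
  measurable : ∀ t, Measurable (X t)
  markov : ∀ t (B : Set (Matrix ι ι ℝ)), MeasurableSet B →
    P⟦X (t + 1) ⁻¹' B | ⨆ s ≤ t, MeasurableSpace.comap (X s) inferInstance⟧
      =ᵐ[P] P⟦X (t + 1) ⁻¹' B | MeasurableSpace.comap (X t) inferInstance⟧
  pair_law : ∀ t, P.map (fun ω => (X t ω, X (t + 1) ω)) =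
    (invWishart (n + 2) (augScale n S F)).map (fun M => (M.toBlocks₁₁, M.toBlocks₂₂))

/-- The joint density `p(x, y)` of `(Σ_{t-1}, Σ_t)`: the block `φ` is integrated out. -/
def pairDensity (n : ℝ) (S F : Matrix ι ι ℝ) (x y : Matrix ι ι ℝ) : ℝ≥0∞ :=
  ∫⁻ φ : ι → ι → ℝ, invWishartPDF (n + 2) (augScale n S F)
    (Matrix.fromBlocks x (Matrix.of φ).transpose (Matrix.of φ) y)

/-- The transition law of the process: the distribution of `Σ_t` given `Σ_{t-1} = x`, with
conditional density `p(x, y) / ∫ p(x, y') dy'`. -/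
def transition (n : ℝ) (S F : Matrix ι ι ℝ) (x : Matrix ι ι ℝ) : Measure (Matrix ι ι ℝ) :=
  (symLebesgue ι).withDensity fun y =>
    pairDensity n S F x y / ∫⁻ y', pairDensity n S F x y' ∂(symLebesgue ι)

/-- The distribution of `Σ_t` given `Σ_0 = x`: `t` successive transitions from `x`. -/
def lawAt (n : ℝ) (S F : Matrix ι ι ℝ) : ℕ → Matrix ι ι ℝ → Measure (Matrix ι ι ℝ)
  | 0, x => Measure.dirac x
  | t + 1, x => (lawAt n S F t x).bind (transition n S F)

/-- The conditional mean `E[Σ_t | Σ_0 = x]`. -/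
def condMean (n : ℝ) (S F : Matrix ι ι ℝ) (t : ℕ) (x : Matrix ι ι ℝ) : Matrix ι ι ℝ :=
  Matrix.of fun i j => ∫ y, y i j ∂(lawAt n S F t x)

/-- The matrix norm `‖A‖_∞` (maximal absolute row sum). -/
def inftyNorm (A : Matrix ι ι ℝ) : ℝ :=
  (Matrix.linftyOpNormedAddCommGroup : NormedAddCommGroup (Matrix ι ι ℝ)).toNorm.norm A

/-- Spectral radius of a real matrix: the largest modulus of its complex eigenvalues. -/
def specRadius (A : Matrix ι ι ℝ) : ℝ≥0∞ :=
  spectralRadius ℂ (A.map (algebraMap ℝ ℂ))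

/-- The parameter matrices are admissible when `S` and `V = S - F S F'` are positive definite. -/
def Admissible (S F : Matrix ι ι ℝ) : Prop :=
  S.PosDef ∧ (S - F * S * F.transpose).PosDef

end IWAR

end

noncomputable section

namespace IWAR

set_option linter.unusedSectionVars false

variable {ι : Type*} [Fintype ι] [DecidableEq ι]

/-! ### Lebesgue measure on symmetric matrices and linear changes of variables. -/

section Volume

variable {κ : Type*} [Fintype κ] [DecidableEq κ]

/-! Everything rests on one formula: given `Σ_{t-1} = x`, the mean of `Σ_t` is `F x F' + ((n + tr(x
S⁻¹)) / (n + q)) V` (`meanStep`).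

To obtain it, the augmented matrix is written in the coordinates `x`, `Γ = φ x⁻¹`, `Ψ = y - φ x⁻¹
φ'`. The inverse Wishart kernel then splits (`invWishartKernel_block`) into a kernel in `x`, an
inverse Wishart kernel in `Ψ` with scale `n V` and `q` more degrees of freedom, and a Gaussian
kernel in `Γ` with mean `F`, row covariance `Ψ` and column covariance `(n S)⁻¹`. Since `y = Ψ + Γ x
Γ'`, its mean given `x` is `E Ψ + F x F' + n⁻¹ tr(x S⁻¹) E Ψ` with `E Ψ = n V / (n + q)`
(`lintegral_transition_quadForm`). The inverse Wishart mean needed here follows from the same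
splitting by induction on the dimension, with the inverse gamma law in dimension one
(`HasInvWishartMoments.sum`, `hasInvWishartMoments`).

As `meanStep` is affine, it commutes with expectations, and the conditional mean after `t` steps is
its `t`-th iterate (`condMean_eq_iterate`). The Markov property shows that this is a version of the
conditional expectation for every process of the class (`IsIWAR.condExp_eq_condMean`). Without its
trace term the recursion is solved by `meanLeading`. The trace term is `O(1/n)` because the iterates
are bounded uniformly in `n` (`exists_norm_iterate_sub_meanLeading_le`). Letting `n → ∞` gives (ii),
and Gelfand's formula for the powers of `F` gives (iii).

Moments are computed in `ℝ≥0∞` for the nonnegative quadratic forms `w' y w`; integrability and the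
entries are recovered by polarization (`integral_entries_of_quadForm`). -/

instance {ι : Type*} [Finite ι] : BorelSpace (Matrix ι ι ℝ) :=
  inferInstanceAs (BorelSpace (ι → ι → ℝ))

instance : SFinite (symLebesgue ι) := by
  unfold symLebesgue; infer_instance

theorem measurable_matrix_iff {α m : Type*} [MeasurableSpace α] {f : α → Matrix m m ℝ} :
    Measurable f ↔ ∀ i j, Measurable fun a => f a i j :=
  ⟨fun h i j => (measurable_pi_apply (X := fun _ => ℝ) j).comp
      ((measurable_pi_apply (X := fun _ => m → ℝ) i).comp h),
    fun h => measurable_pi_lambda (X := fun _ => m → ℝ) _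
      fun i => measurable_pi_lambda (X := fun _ => ℝ) _ fun j => h i j⟩

theorem measurable_matrix_apply {m : Type*} (i j : m) :
    Measurable fun M : Matrix m m ℝ => M i j :=
  measurable_matrix_iff.1 measurable_id i j

@[fun_prop]
theorem measurable_symMat {ι : Type*} : Measurable (symMat : (Sym2 ι → ℝ) → Matrix ι ι ℝ) :=
  measurable_matrix_iff.2 fun _ _ => measurable_pi_apply _

theorem exists_symMat {ι : Type*} {A : Matrix ι ι ℝ} (hA : A.transpose = A) :
    ∃ z : Sym2 ι → ℝ, symMat z = A := by
  refine ⟨Sym2.lift ⟨fun i j => A i j, fun i j => ?_⟩, ?_⟩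
  · conv_lhs => rw [← hA]
    rfl
  · ext i j; simp [symMat]

theorem lintegral_symLebesgue_add_right (f : Matrix ι ι ℝ → ℝ≥0∞) (hf : Measurable f)
    {A : Matrix ι ι ℝ} (hA : A.transpose = A) :
    ∫⁻ M, f (M + A) ∂symLebesgue ι = ∫⁻ M, f M ∂symLebesgue ι := by
  obtain ⟨w, rfl⟩ := exists_symMat hA
  have hadd : Measurable fun M : Matrix ι ι ℝ => M + symMat w :=
    (by fun_prop : Continuous fun M : Matrix ι ι ℝ => M + symMat w).measurable
  rw [symLebesgue, lintegral_map (f := fun M => f (M + symMat w)) (hf.comp hadd) (by fun_prop),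
    lintegral_map hf (by fun_prop)]
  exact lintegral_add_right_eq_self (fun z => f (symMat z)) w

/-- The unordered pairs in a disjoint union. -/
def sym2SumEquiv (ι κ : Type*) : (Sym2 ι ⊕ Sym2 κ) ⊕ (κ × ι) ≃ Sym2 (ι ⊕ κ) :=
  Equiv.ofBijective
    (Sum.elim (Sum.elim (Sym2.map Sum.inl) (Sym2.map Sum.inr)) fun p => s(Sum.inr p.1, Sum.inl p.2))
    (by
      constructor
      · rintro ((a | a) | ⟨a, a'⟩) ((b | b) | ⟨b, b'⟩) <;>
          first
          | (induction a using Sym2.ind; induction b using Sym2.ind; simp)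
          | (induction a using Sym2.ind; simp)
          | (induction b using Sym2.ind; simp)
          | simp +contextual
      · intro p
        induction p using Sym2.ind with
        | _ x y =>
          rcases x with x | x <;> rcases y with y | y
          · exact ⟨.inl (.inl s(x, y)), rfl⟩
          · exact ⟨.inr (y, x), Sym2.eq_swap⟩
          · exact ⟨.inr (x, y), rfl⟩
          · exact ⟨.inl (.inr s(x, y)), rfl⟩)

theorem measurePreserving_curry (ι κ : Type*) [Fintype ι] [Fintype κ] :
    MeasurePreserving (MeasurableEquiv.curry ι κ ℝ) volume volume := by
  refine MeasurePreserving.symm _ ⟨(MeasurableEquiv.curry ι κ ℝ).symm.measurable, ?_⟩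
  refine (Measure.pi_eq fun s hs => ?_).symm
  rw [MeasurableEquiv.map_apply]
  have : (MeasurableEquiv.curry ι κ ℝ).symm ⁻¹' (Set.univ.pi s)
      = Set.univ.pi fun i => Set.univ.pi fun j => s (i, j) := by
    ext x
    simp [MeasurableEquiv.coe_curry_symm, Function.uncurry]
  rw [this, volume_pi_pi]
  simp_rw [volume_pi_pi]
  rw [Fintype.prod_prod_type]

@[fun_prop]
theorem measurable_fromBlocks {α : Type*} [MeasurableSpace α] {x : α → Matrix ι ι ℝ}
    {y : α → Matrix κ κ ℝ} {φ : α → κ → ι → ℝ} (hx : Measurable x) (hy : Measurable y)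
    (hφ : Measurable φ) :
    Measurable fun a =>
      Matrix.fromBlocks (x a) (Matrix.of (φ a)).transpose (Matrix.of (φ a)) (y a) := by
  refine measurable_matrix_iff.2 fun i j => ?_
  rcases i with i | i <;> rcases j with j | j
  · exact measurable_matrix_iff.1 hx i j
  · exact (measurable_pi_apply i).comp ((measurable_pi_apply j).comp hφ)
  · exact (measurable_pi_apply j).comp ((measurable_pi_apply i).comp hφ)
  · exact measurable_matrix_iff.1 hy i j

/-- An unordered pair from a disjoint union lies in one part, in the other, or across both. The
measure is therefore the product of the two symmetric Lebesgue measures and of ordinary Lebesgue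
measure on the rectangular block. -/
theorem lintegral_symLebesgue_sum (f : Matrix (ι ⊕ κ) (ι ⊕ κ) ℝ → ℝ≥0∞) (hf : Measurable f) :
    ∫⁻ M, f M ∂symLebesgue (ι ⊕ κ) =
      ∫⁻ x, (∫⁻ y, (∫⁻ φ : κ → ι → ℝ,
        f (Matrix.fromBlocks x (Matrix.of φ).transpose (Matrix.of φ) y)) ∂symLebesgue κ)
          ∂symLebesgue ι := by
  have hm1 : Measurable fun p : (Matrix ι ι ℝ × Matrix κ κ ℝ) × (κ → ι → ℝ) =>
      f (Matrix.fromBlocks p.1.1 (Matrix.of p.2).transpose (Matrix.of p.2) p.1.2) := by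
    fun_prop
  have hm2 : Measurable fun p : Matrix ι ι ℝ × Matrix κ κ ℝ => ∫⁻ φ : κ → ι → ℝ,
      f (Matrix.fromBlocks p.1 (Matrix.of φ).transpose (Matrix.of φ) p.2) :=
    hm1.lintegral_prod_right'
  have hm3 : Measurable fun x : Matrix ι ι ℝ => ∫⁻ y, (∫⁻ φ : κ → ι → ℝ,
      f (Matrix.fromBlocks x (Matrix.of φ).transpose (Matrix.of φ) y)) ∂symLebesgue κ :=
    hm2.lintegral_prod_right'
  have hΦ := (volume_measurePreserving_piCongrLeft (fun _ => ℝ) (sym2SumEquiv ι κ)).comp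
    ((volume_measurePreserving_sumPiEquivProdPi_symm
        (fun _ : (Sym2 ι ⊕ Sym2 κ) ⊕ (κ × ι) => ℝ)).comp
      ((volume_measurePreserving_sumPiEquivProdPi_symm (fun _ : Sym2 ι ⊕ Sym2 κ => ℝ)).prod
        (measurePreserving_curry κ ι).symm))
  have hcomp : ∀ p : ((Sym2 ι → ℝ) × (Sym2 κ → ℝ)) × (κ → ι → ℝ),
      symMat ((MeasurableEquiv.piCongrLeft (fun _ => ℝ) (sym2SumEquiv ι κ))
        ((MeasurableEquiv.sumPiEquivProdPi (fun _ : (Sym2 ι ⊕ Sym2 κ) ⊕ (κ × ι) => ℝ)).symm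
        ((MeasurableEquiv.sumPiEquivProdPi (fun _ : Sym2 ι ⊕ Sym2 κ => ℝ)).symm p.1,
          (MeasurableEquiv.curry κ ι ℝ).symm p.2))) =
      Matrix.fromBlocks (symMat p.1.1) (Matrix.of p.2).transpose (Matrix.of p.2)
        (symMat p.1.2) := by
    intro p
    have key : ∀ (g : (Sym2 ι ⊕ Sym2 κ) ⊕ (κ × ι) → ℝ) j,
        (MeasurableEquiv.piCongrLeft (fun _ => ℝ) (sym2SumEquiv ι κ)) g (sym2SumEquiv ι κ j)
          = g j := fun g j => Equiv.piCongrLeft_apply_apply (fun _ => ℝ) _ g j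
    ext i j
    rcases i with i | i <;> rcases j with j | j
    · exact key _ (.inl (.inl s(i, j)))
    · simp only [symMat, Matrix.of_apply]
      rw [Sym2.eq_swap]
      exact key _ (.inr (j, i))
    · exact key _ (.inr (i, j))
    · exact key _ (.inl (.inr s(i, j)))
  rw [symLebesgue, lintegral_map hf (by fun_prop),
    ← hΦ.lintegral_comp (f := fun z => f (symMat z)) (by fun_prop), symLebesgue,
    lintegral_map hm3 (by fun_prop)]
  simp only [Function.comp_apply, Prod.map, hcomp]
  have hm4 : Measurable fun p : ((Sym2 ι → ℝ) × (Sym2 κ → ℝ)) × (κ → ι → ℝ) =>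
      f (Matrix.fromBlocks (symMat p.1.1) (Matrix.of p.2).transpose (Matrix.of p.2)
        (symMat p.1.2)) := by fun_prop
  have hm5 : Measurable fun p : (Sym2 ι → ℝ) × (Sym2 κ → ℝ) => ∫⁻ φ : κ → ι → ℝ,
      f (Matrix.fromBlocks (symMat p.1) (Matrix.of φ).transpose (Matrix.of φ) (symMat p.2)) :=
    hm4.lintegral_prod_right'
  have hsplit := lintegral_prod (μ := (volume : Measure ((Sym2 ι → ℝ) × (Sym2 κ → ℝ))))
    (ν := (volume : Measure (κ → ι → ℝ))) _ hm4.aemeasurable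
  refine hsplit.trans ((lintegral_prod _ hm5.aemeasurable).trans (lintegral_congr fun z => ?_))
  rw [symLebesgue]
  exact (lintegral_map (hm2.comp measurable_prodMk_left) (by fun_prop)).symm

theorem lintegral_of_map_linear {E : Type*} [NormedAddCommGroup E] [NormedSpace ℝ E]
    [MeasurableSpace E] [BorelSpace E] [FiniteDimensional ℝ E] (μ : Measure E) [μ.IsAddHaarMeasure]
    {T : E →ₗ[ℝ] E} (hT : LinearMap.det T ≠ 0) {f : E → ℝ≥0∞} (hf : Measurable f) :
    ∫⁻ x, f x ∂μ = ENNReal.ofReal |LinearMap.det T| * ∫⁻ x, f (T x) ∂μ := by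
  have hm : Measurable T := T.continuous_of_finiteDimensional.measurable
  rw [← lintegral_map hf hm, Measure.map_linearMap_addHaar_eq_smul_addHaar μ hT,
    lintegral_smul_measure, smul_eq_mul, ← mul_assoc, ← ENNReal.ofReal_mul (abs_nonneg _),
    ← abs_mul, mul_inv_cancel₀ hT]
  simp

/-- The map acts on each of the `card κ` rows separately, whence the exponent of the Jacobian. For
left multiplication, conjugation by transposition reduces to the columns. -/
theorem lintegral_mul_matrix_right (f : (κ → ι → ℝ) → ℝ≥0∞) (hf : Measurable f)
    {A : Matrix ι ι ℝ} (hA : A.det ≠ 0) :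
    ∫⁻ φ : κ → ι → ℝ, f φ = ENNReal.ofReal (|A.det| ^ Fintype.card κ) *
      ∫⁻ φ : κ → ι → ℝ, f (Matrix.of.symm (Matrix.of φ * A)) := by
  have hdet : LinearMap.det (LinearMap.pi fun k : κ =>
      (Matrix.vecMulLinear A).comp (LinearMap.proj k)) = A.det ^ Fintype.card κ := by
    rw [LinearMap.det_pi, Finset.prod_const, Finset.card_univ]
    congr 1
    rw [← Matrix.det_transpose A, ← LinearMap.det_toLin']
    congr 1
    ext
    simp
  rw [lintegral_of_map_linear volume (T := LinearMap.pi fun k : κ =>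
      (Matrix.vecMulLinear A).comp (LinearMap.proj k)) (by rw [hdet]; exact pow_ne_zero _ hA) hf,
    hdet, abs_pow]
  rfl

theorem lintegral_mul_matrix_left (f : (κ → ι → ℝ) → ℝ≥0∞) (hf : Measurable f)
    {A : Matrix κ κ ℝ} (hA : A.det ≠ 0) :
    ∫⁻ φ : κ → ι → ℝ, f φ = ENNReal.ofReal (|A.det| ^ Fintype.card ι) *
      ∫⁻ φ : κ → ι → ℝ, f (Matrix.of.symm (A * Matrix.of φ)) := by
  have hdet : LinearMap.det (LinearMap.pi fun k : ι =>
      (Matrix.mulVecLin A).comp (LinearMap.proj k)) = A.det ^ Fintype.card ι := by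
    rw [LinearMap.det_pi, Finset.prod_const, Finset.card_univ]
    congr 1
    exact LinearMap.det_toLin' A
  let e : (ι → κ → ℝ) ≃ₗ[ℝ] (κ → ι → ℝ) := Matrix.transposeLinearEquiv ι κ ℝ ℝ
  have hconj := LinearMap.det_conj (LinearMap.pi fun k : ι =>
      (Matrix.mulVecLin A).comp (LinearMap.proj k)) e
  rw [lintegral_of_map_linear volume (T := _) (by rw [hconj, hdet]; exact pow_ne_zero _ hA) hf,
    hconj, hdet, abs_pow]
  rfl

end Volume

/-! ### Second moments of affine functions of a standard Gaussian vector. -/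

section Gaussian

variable {J : Type*} [Fintype J]

theorem pi_gaussianReal_eq_withDensity :
    Measure.pi (fun _ : J => gaussianReal 0 1) =
      (volume : Measure (J → ℝ)).withDensity
        fun z => ENNReal.ofReal (∏ j, gaussianPDFReal 0 1 (z j)) := by
  refine Measure.pi_eq fun s hs => ?_
  have hint : ∀ j, Integrable (gaussianPDFReal 0 1) (volume.restrict (s j)) := fun j =>
    (integrable_gaussianPDFReal 0 1).restrict
  rw [withDensity_apply _ (.univ_pi hs), volume_pi, Measure.restrict_pi_pi,
    ← ofReal_integral_eq_lintegral_ofReal (Integrable.fintype_prod hint)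
      (ae_of_all _ fun z => Finset.prod_nonneg fun j _ => gaussianPDFReal_nonneg _ _ _),
    integral_fintype_prod_eq_prod (f := fun _ => gaussianPDFReal 0 1),
    ENNReal.ofReal_prod_of_nonneg fun j _ => integral_nonneg fun x => gaussianPDFReal_nonneg _ _ _]
  exact Finset.prod_congr rfl fun j _ => (gaussianReal_apply_eq_integral 0 one_ne_zero _).symm

theorem prod_gaussianPDFReal (z : J → ℝ) :
    ∏ j, gaussianPDFReal 0 1 (z j) =
      (√(2 * Real.pi) ^ Fintype.card J)⁻¹ * Real.exp (-(∑ j, z j ^ 2) / 2) := by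
  simp only [gaussianPDFReal, Finset.prod_mul_distrib, Finset.prod_const, Finset.card_univ,
    ← Real.exp_sum]
  congr 2
  · simp [← inv_pow, mul_comm]
  · rw [neg_div, Finset.sum_div, ← Finset.sum_neg_distrib]
    simp [neg_div]

/-- The coordinates are independent and centred, so the linear part has mean zero and its variance
is the sum of the variances. -/
theorem integral_affine_sq_pi_gaussianReal (m : ℝ) (c : J → ℝ) :
    Integrable (fun z : J → ℝ => (m + ∑ j, c j * z j) ^ 2)
        (Measure.pi fun _ => gaussianReal 0 1) ∧
      ∫ z : J → ℝ, (m + ∑ j, c j * z j) ^ 2 ∂(Measure.pi fun _ => gaussianReal 0 1) =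
        m ^ 2 + ∑ j, c j ^ 2 := by
  set μ := Measure.pi fun _ : J => gaussianReal 0 1
  have hL1 : ∀ j, MemLp (fun x : ℝ => c j * x) 2 (gaussianReal 0 1) := fun j =>
    (memLp_id_gaussianReal 2).const_mul (c j)
  have hLj : ∀ j, MemLp (fun z : J → ℝ => c j * z j) 2 μ := fun j =>
    (hL1 j).comp_measurePreserving (measurePreserving_eval _ j)
  have hL : MemLp (∑ j, fun z : J → ℝ => c j * z j) 2 μ := memLp_finsetSum' _ fun j _ => hLj j
  have hvar := variance_sum_pi (μ := fun _ : J => gaussianReal 0 1)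
    (X := fun j (x : ℝ) => c j * x) hL1
  have hmean : ∫ z, (∑ j, fun z : J → ℝ => c j * z j) z ∂μ = 0 := by
    simp only [Finset.sum_apply]
    rw [integral_finsetSum _ fun j _ => (hLj j).integrable one_le_two]
    refine Finset.sum_eq_zero fun j _ => ?_
    rw [integral_const_mul]
    rw [integral_eval, integral_id_gaussianReal, mul_zero]
  have hsq : ∫ z, (∑ j, fun z : J → ℝ => c j * z j) z ^ 2 ∂μ = ∑ j, c j ^ 2 := by
    have h := variance_eq_sub hL
    rw [hmean, hvar] at h
    have hv : ∀ j, Var[fun x => c j * x; gaussianReal 0 1] = c j ^ 2 := fun j => by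
      rw [variance_const_mul, variance_fun_id_gaussianReal]; simp
    rw [Finset.sum_congr rfl fun j _ => hv j] at h
    simpa using h.symm
  have heq : ∀ z : J → ℝ, (m + ∑ j, c j * z j) ^ 2 =
      m ^ 2 + 2 * m * (∑ j, fun z : J → ℝ => c j * z j) z +
        (∑ j, fun z : J → ℝ => c j * z j) z ^ 2 := by
    intro z; rw [Finset.sum_apply]; ring
  have hi1 : Integrable (fun z => m ^ 2 + 2 * m * (∑ j, fun z : J → ℝ => c j * z j) z) μ :=
    (integrable_const _).add ((hL.integrable one_le_two).const_mul _)
  simp_rw [heq]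
  refine ⟨hi1.add hL.integrable_sq, ?_⟩
  rw [integral_add hi1 hL.integrable_sq, hsq, integral_add (integrable_const _)
    ((hL.integrable one_le_two).const_mul _), integral_const_mul, hmean]
  simp

theorem lintegral_exp_mul_affine_sq (m : ℝ) (c : J → ℝ) :
    ∫⁻ z : J → ℝ, ENNReal.ofReal (Real.exp (-(∑ j, z j ^ 2) / 2)) *
        ENNReal.ofReal ((m + ∑ j, c j * z j) ^ 2) =
      ENNReal.ofReal (√(2 * Real.pi) ^ Fintype.card J) * ENNReal.ofReal (m ^ 2 + ∑ j, c j ^ 2) := by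
  obtain ⟨h1, h2⟩ := integral_affine_sq_pi_gaussianReal m c
  have hpos : 0 < √(2 * Real.pi) ^ Fintype.card J := by positivity
  rw [← h2, ofReal_integral_eq_lintegral_ofReal h1 (ae_of_all _ fun z => sq_nonneg _),
    pi_gaussianReal_eq_withDensity, lintegral_withDensity_eq_lintegral_mul _ (by
      refine ENNReal.measurable_ofReal.comp (Finset.measurable_prod _ fun j _ => ?_)
      exact (measurable_gaussianPDFReal 0 1).comp (measurable_pi_apply j)) (by fun_prop),
    ← lintegral_const_mul _ (by
      refine Measurable.mul (ENNReal.measurable_ofReal.comp (Finset.measurable_prod _ fun j _ => ?_))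
        (by fun_prop)
      exact (measurable_gaussianPDFReal 0 1).comp (measurable_pi_apply j))]
  refine lintegral_congr fun z => ?_
  rw [Pi.mul_apply, prod_gaussianPDFReal, ← mul_assoc, ← ENNReal.ofReal_mul hpos.le,
    mul_inv_cancel_left₀ hpos.ne']

end Gaussian

/-! ### Schur complements: positivity, determinant and trace in block coordinates. -/

section Block

open Matrix
open scoped MatrixOrder

variable {κ : Type*} [Fintype κ] [DecidableEq κ]

theorem exists_symm_sqrt {A : Matrix ι ι ℝ} (hA : A.PosSemidef) :
    ∃ R : Matrix ι ι ℝ, Rᵀ = R ∧ R * R = A := by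
  refine ⟨CFC.sqrt A, ?_, CFC.sqrt_mul_sqrt_self A hA.nonneg⟩
  have := (CFC.sqrt_nonneg A).isSelfAdjoint
  rwa [IsSelfAdjoint, star_eq_conjTranspose, conjTranspose_eq_transpose_of_trivial] at this

/-- Block `LDL'` factorization. It reduces positivity, the determinant and the inverse to those of
the diagonal matrix with blocks `x` and `Ψ`, since the outer factors are unipotent. -/
theorem fromBlocks_eq_conj (x : Matrix ι ι ℝ) (Γ : Matrix κ ι ℝ) (Ψ : Matrix κ κ ℝ)
    (hx : xᵀ = x) :
    fromBlocks x (Γ * x)ᵀ (Γ * x) (Ψ + Γ * x * Γᵀ) =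
      fromBlocks 1 0 Γ 1 * fromBlocks x 0 0 Ψ * (fromBlocks 1 0 Γ 1)ᵀ := by
  simp [fromBlocks_multiply, fromBlocks_transpose, hx, add_comm]

theorem isUnit_lower (Γ : Matrix κ ι ℝ) :
    IsUnit (fromBlocks (1 : Matrix ι ι ℝ) 0 Γ (1 : Matrix κ κ ℝ)) := by
  rw [isUnit_fromBlocks_zero₁₂]; exact ⟨isUnit_one, isUnit_one⟩

theorem posDef_fromBlocks_diag {x : Matrix ι ι ℝ} {Ψ : Matrix κ κ ℝ} :
    (fromBlocks x 0 0 Ψ).PosDef ↔ x.PosDef ∧ Ψ.PosDef := by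
  constructor
  · intro h
    exact ⟨h.submatrix (e := Sum.inl) Sum.inl_injective, h.submatrix (e := Sum.inr) Sum.inr_injective⟩
  · rintro ⟨hx, hΨ⟩
    refine PosDef.of_dotProduct_mulVec_pos ?_ ?_
    · rw [isHermitian_fromBlocks_iff]; exact ⟨hx.isHermitian, conjTranspose_zero, conjTranspose_zero, hΨ.isHermitian⟩
    · intro v hv
      obtain ⟨a, w, rfl⟩ : ∃ a w, v = Sum.elim a w := ⟨v ∘ Sum.inl, v ∘ Sum.inr, by simp⟩
      have h1 := hx.posSemidef.dotProduct_mulVec_nonneg a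
      have h2 := hΨ.posSemidef.dotProduct_mulVec_nonneg w
      have : star (Sum.elim a w) ⬝ᵥ (fromBlocks x 0 0 Ψ *ᵥ Sum.elim a w) =
        star a ⬝ᵥ x *ᵥ a + star w ⬝ᵥ Ψ *ᵥ w := by
        simp [fromBlocks_mulVec, sumElim_dotProduct_sumElim]
      rw [this]
      by_cases ha : a = 0
      · have hw : w ≠ 0 := by
          rintro rfl; apply hv; ext i; cases i <;> simp [ha]
        have := hΨ.dotProduct_mulVec_pos hw
        linarith
      · have := hx.dotProduct_mulVec_pos ha
        linarith

theorem posDef_block_iff {x : Matrix ι ι ℝ} (hx : x.PosDef) (Γ : Matrix κ ι ℝ)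
    (Ψ : Matrix κ κ ℝ) :
    (fromBlocks x (Γ * x)ᵀ (Γ * x) (Ψ + Γ * x * Γᵀ)).PosDef ↔ Ψ.PosDef := by
  rw [fromBlocks_eq_conj x Γ Ψ (by simpa using hx.isHermitian.eq),
    ← conjTranspose_eq_transpose_of_trivial, ← star_eq_conjTranspose,
    (isUnit_lower Γ).posDef_star_right_conjugate_iff, posDef_fromBlocks_diag]
  simp [hx]

theorem det_block (x : Matrix ι ι ℝ) (Γ : Matrix κ ι ℝ) (Ψ : Matrix κ κ ℝ) (hx : xᵀ = x) :
    (fromBlocks x (Γ * x)ᵀ (Γ * x) (Ψ + Γ * x * Γᵀ)).det = x.det * Ψ.det := by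
  rw [fromBlocks_eq_conj x Γ Ψ hx, det_mul, det_mul, det_transpose, det_fromBlocks_zero₁₂,
    det_fromBlocks_zero₁₂]
  simp

theorem trace_fromBlocks' (A : Matrix ι ι ℝ) (B : Matrix ι κ ℝ) (C : Matrix κ ι ℝ)
    (E : Matrix κ κ ℝ) : (fromBlocks A B C E).trace = A.trace + E.trace := by
  simp [Matrix.trace]

/-- Completion of the square in `Γ`. The last term is the exponent of a matrix normal law centred at
`C * A⁻¹`, and the middle one involves only the Schur complement of the scale matrix. -/
theorem trace_block_inv {x : Matrix ι ι ℝ} (hx : x.PosDef) (Γ : Matrix κ ι ℝ)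
    {Ψ : Matrix κ κ ℝ} (hΨ : Ψ.PosDef) {A : Matrix ι ι ℝ} (hA : A.PosDef)
    (C : Matrix κ ι ℝ) (E : Matrix κ κ ℝ) :
    (fromBlocks A Cᵀ C E * (fromBlocks x (Γ * x)ᵀ (Γ * x) (Ψ + Γ * x * Γᵀ))⁻¹).trace =
      (A * x⁻¹).trace + ((E - C * A⁻¹ * Cᵀ) * Ψ⁻¹).trace +
        ((Γ - C * A⁻¹) * A * (Γ - C * A⁻¹)ᵀ * Ψ⁻¹).trace := by
  have hxT : xᵀ = x := by simpa using hx.isHermitian.eq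
  have hAT : Aᵀ = A := by simpa using hA.isHermitian.eq
  have hxd : IsUnit x.det := (isUnit_iff_isUnit_det _).1 hx.isUnit
  have hΨd : IsUnit Ψ.det := (isUnit_iff_isUnit_det _).1 hΨ.isUnit
  have hAd : IsUnit A.det := (isUnit_iff_isUnit_det _).1 hA.isUnit
  -- The unipotent factor is inverted by changing the sign of `Γ`.
  have hinv : (fromBlocks x (Γ * x)ᵀ (Γ * x) (Ψ + Γ * x * Γᵀ))⁻¹ =
      (fromBlocks 1 0 (-Γ) 1)ᵀ * fromBlocks x⁻¹ 0 0 Ψ⁻¹ * fromBlocks 1 0 (-Γ) 1 := by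
    refine inv_eq_right_inv ?_
    rw [fromBlocks_eq_conj x Γ Ψ hxT]
    simp [fromBlocks_multiply, fromBlocks_transpose, Matrix.mul_assoc, Matrix.mul_add,
      Matrix.add_mul, mul_nonsing_inv _ hxd, mul_nonsing_inv _ hΨd,
      mul_nonsing_inv_cancel_left _ _ hΨd]
    rw [← fromBlocks_one]
    congr 1
    abel
  rw [hinv, ← Matrix.mul_assoc, trace_mul_comm, ← Matrix.mul_assoc, ← Matrix.mul_assoc,
    fromBlocks_transpose, fromBlocks_multiply, fromBlocks_multiply, fromBlocks_multiply,
    trace_fromBlocks', add_assoc, ← trace_add, ← Matrix.add_mul]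
  have hAinvT : (A⁻¹)ᵀ = A⁻¹ := by rw [transpose_nonsing_inv, hAT]
  congr 2
  · simp
  · simp only [transpose_one, transpose_zero, transpose_neg, transpose_sub, transpose_mul, hAinvT,
      Matrix.one_mul, Matrix.mul_one, Matrix.mul_zero, zero_add, add_zero,
      Matrix.sub_mul, Matrix.mul_sub, Matrix.mul_neg, Matrix.neg_mul, Matrix.add_mul]
    have h1 : C * A⁻¹ * A = C := by rw [Matrix.mul_assoc, nonsing_inv_mul _ hAd, Matrix.mul_one]
    have h2 : Γ * A * (A⁻¹ * Cᵀ) = Γ * Cᵀ := by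
      rw [Matrix.mul_assoc, mul_nonsing_inv_cancel_left _ _ hAd]
    rw [h1, h2, ← Matrix.mul_assoc C]
    abel

end Block

/-! ### Measurability and block factorization of the inverse Wishart kernel. -/

section Kernel

open Matrix

variable {κ : Type*} [Fintype κ] [DecidableEq κ]

/-- An uncountable intersection of strict inequalities is not visibly measurable. Positive definite
means semidefinite, a closed condition, with nonzero determinant, an open one. -/
theorem measurableSet_posDef : MeasurableSet {M : Matrix ι ι ℝ | M.PosDef} := by
  have h : {M : Matrix ι ι ℝ | M.PosDef} =
      ({M | Mᵀ = M} ∩ ⋂ v : ι → ℝ, {M | 0 ≤ v ⬝ᵥ M *ᵥ v}) ∩ {M | M.det ≠ 0} := by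
    ext M
    simp only [Set.mem_ofPred_eq, Set.mem_inter_iff, Set.mem_iInter]
    constructor
    · intro hM
      exact ⟨⟨by simpa using hM.isHermitian.eq, fun v => by
        simpa using hM.posSemidef.dotProduct_mulVec_nonneg v⟩, hM.det_pos.ne'⟩
    · rintro ⟨⟨h1, h2⟩, h3⟩
      have : M.PosSemidef := PosSemidef.of_dotProduct_mulVec_nonneg (by
        rw [IsHermitian, conjTranspose_eq_transpose_of_trivial, h1]) fun v => by simpa using h2 v
      exact this.posDef_iff_det_ne_zero.2 h3
  rw [h]
  refine MeasurableSet.inter (IsClosed.measurableSet ?_) (IsOpen.measurableSet ?_)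
  · refine (isClosed_eq (by fun_prop) (by fun_prop)).inter (isClosed_iInter fun v => ?_)
    exact isClosed_le (by fun_prop) (by fun_prop)
  · exact isOpen_ne_fun (by fun_prop) (by fun_prop)

theorem measurable_det : Measurable (det : Matrix ι ι ℝ → ℝ) :=
  (by fun_prop : Continuous (det : Matrix ι ι ℝ → ℝ)).measurable

theorem measurable_matrix_inv : Measurable fun M : Matrix ι ι ℝ => M⁻¹ := by
  refine measurable_matrix_iff.2 fun i j => ?_
  simp only [inv_def, Ring.inverse_eq_inv', Matrix.smul_apply, smul_eq_mul]
  exact measurable_det.inv.mul (by fun_prop : Continuous fun M : Matrix ι ι ℝ =>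
    M.adjugate i j).measurable

theorem measurable_invWishartKernel (d : ℝ) (D : Matrix ι ι ℝ) :
    Measurable (invWishartKernel d D) := by
  classical
  have ht : Measurable fun M : Matrix ι ι ℝ => (D * M⁻¹).trace :=
    (by fun_prop : Continuous fun N : Matrix ι ι ℝ => (D * N).trace).measurable.comp
      measurable_matrix_inv
  refine Measurable.ite measurableSet_posDef (ENNReal.measurable_ofReal.comp ?_) measurable_const
  exact (measurable_det.pow_const _).mul (Real.measurable_exp.comp (ht.neg.div_const _))

/-- The unnormalized density of the matrix normal law with mean `C A⁻¹`, row covariance `Ψ` and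
column covariance `A⁻¹`. -/
def matrixNormalKernel (A : Matrix ι ι ℝ) (C : Matrix κ ι ℝ) (Ψ : Matrix κ κ ℝ) (Γ : Matrix κ ι ℝ) :
    ℝ≥0∞ :=
  ENNReal.ofReal (Ψ.det ^ (-((Fintype.card ι : ℝ) / 2)) *
    Real.exp (-((Γ - C * A⁻¹) * A * (Γ - C * A⁻¹)ᵀ * Ψ⁻¹).trace / 2))

/-- The power of `x.det` on the left is the Jacobian of `φ = Γ x`, and it brings the exponent of
`x.det` down to dimension `card ι`. The surplus exponent of `Ψ.det` is shared: half of `card ι`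
raises the degrees of freedom of `Ψ`, the other half normalizes the Gaussian kernel. -/
theorem invWishartKernel_block (d : ℝ) {x : Matrix ι ι ℝ} (hx : x.PosDef) (Γ : Matrix κ ι ℝ)
    (Ψ : Matrix κ κ ℝ) {A : Matrix ι ι ℝ} (hA : A.PosDef) (C : Matrix κ ι ℝ) (E : Matrix κ κ ℝ) :
    ENNReal.ofReal (x.det ^ Fintype.card κ) *
      invWishartKernel d (fromBlocks A Cᵀ C E)
        (fromBlocks x (Γ * x)ᵀ (Γ * x) (Ψ + Γ * x * Γᵀ)) =
      invWishartKernel d A x *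
        (invWishartKernel (d + Fintype.card ι) (E - C * A⁻¹ * Cᵀ) Ψ *
          matrixNormalKernel A C Ψ Γ) := by
  unfold invWishartKernel
  rw [if_pos hx]
  by_cases hΨ : Ψ.PosDef
  · rw [if_pos ((posDef_block_iff hx Γ Ψ).2 hΨ), if_pos hΨ, det_block x Γ Ψ
      (by simpa using hx.isHermitian.eq), trace_block_inv hx Γ hΨ hA C E, matrixNormalKernel]
    have h1 := hx.det_pos
    have h2 := hΨ.det_pos
    rw [← ENNReal.ofReal_mul (by positivity), ← ENNReal.ofReal_mul (by positivity),
      ← ENNReal.ofReal_mul (by positivity)]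
    congr 1
    rw [Real.mul_rpow h1.le h2.le, Fintype.card_sum, Nat.cast_add]
    have e3 : ∀ a b c : ℝ, Real.exp (-(a + b + c) / 2) =
        Real.exp (-a / 2) * (Real.exp (-b / 2) * Real.exp (-c / 2)) := fun a b c => by
      rw [← Real.exp_add, ← Real.exp_add]; congr 1; ring
    have e1 : x.det ^ Fintype.card κ *
        x.det ^ (-(d / 2 + ((Fintype.card ι : ℝ) + Fintype.card κ))) =
        x.det ^ (-(d / 2 + (Fintype.card ι : ℝ))) := by
      rw [← Real.rpow_natCast, ← Real.rpow_add h1]; congr 1; ring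
    have e2 : Ψ.det ^ (-(d / 2 + ((Fintype.card ι : ℝ) + Fintype.card κ))) =
        Ψ.det ^ (-((d + Fintype.card ι) / 2 + (Fintype.card κ : ℝ))) *
          Ψ.det ^ (-((Fintype.card ι : ℝ) / 2)) := by
      rw [← Real.rpow_add h2]; congr 1; ring
    rw [e2, e3, ← e1]
    ring
  · rw [if_neg (fun h => hΨ ((posDef_block_iff hx Γ Ψ).1 h)), if_neg hΨ]
    simp

theorem invWishartKernel_of_not_posDef (d : ℝ) (D : Matrix ι ι ℝ) {M : Matrix ι ι ℝ}
    (hM : ¬M.PosDef) : invWishartKernel d D M = 0 := if_neg hM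

end Kernel

/-! ### Mass and second moments of the matrix normal kernel. -/

section MatrixNormal

open Matrix

variable {κ : Type*} [Fintype κ] [DecidableEq κ]

theorem lintegral_exp_mul_affine_sq_curried (m : ℝ) (c : κ → ι → ℝ) :
    ∫⁻ Z : κ → ι → ℝ, ENNReal.ofReal (Real.exp (-(∑ k, ∑ i, Z k i ^ 2) / 2)) *
        ENNReal.ofReal ((m + ∑ k, ∑ i, c k i * Z k i) ^ 2) =
      ENNReal.ofReal (√(2 * Real.pi) ^ (Fintype.card κ * Fintype.card ι)) *
        ENNReal.ofReal (m ^ 2 + ∑ k, ∑ i, c k i ^ 2) := by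
  have h := lintegral_exp_mul_affine_sq m fun p : κ × ι => c p.1 p.2
  rw [Fintype.card_prod, Fintype.sum_prod_type] at h
  rw [← h, ← (measurePreserving_curry κ ι).lintegral_comp (by fun_prop)]
  refine lintegral_congr fun z => ?_
  simp [Fintype.sum_prod_type]

/-- The total mass of `matrixNormalKernel A C Ψ`. -/
def matrixNormalMass (κ : Type*) [Fintype κ] (A : Matrix ι ι ℝ) : ℝ≥0∞ :=
  ENNReal.ofReal (√(2 * Real.pi) ^ (Fintype.card κ * Fintype.card ι) *
    (√A.det ^ Fintype.card κ)⁻¹)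

theorem matrixNormalMass_ne_zero {A : Matrix ι ι ℝ} (hA : A.PosDef) :
    matrixNormalMass κ A ≠ 0 := by
  have := hA.det_pos
  have h2 : 0 < √A.det := Real.sqrt_pos.2 this
  rw [matrixNormalMass, Ne, ENNReal.ofReal_eq_zero, not_le]
  positivity

theorem matrixNormalMass_ne_top {A : Matrix ι ι ℝ} : matrixNormalMass κ A ≠ ∞ :=
  ENNReal.ofReal_ne_top

theorem trace_mul_transpose_self (Z : Matrix κ ι ℝ) : (Z * Zᵀ).trace = ∑ k, ∑ i, Z k i ^ 2 := by
  simp [Matrix.trace, Matrix.mul_apply, sq]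

/-- Standardization of a matrix normal integral. -/
theorem lintegral_matrixNormalKernel_mul {A : Matrix ι ι ℝ} (hA : A.PosDef) (C : Matrix κ ι ℝ)
    {Ψ : Matrix κ κ ℝ} (hΨ : Ψ.PosDef) {P : Matrix κ κ ℝ} {Q : Matrix ι ι ℝ} (hPT : Pᵀ = P)
    (hP : P * P = Ψ) (hQT : Qᵀ = Q) (hQ : Q * Q = A⁻¹) {f : Matrix κ ι ℝ → ℝ≥0∞}
    (hf : Measurable fun φ : κ → ι → ℝ => f (of φ)) :
    ∫⁻ Γ : κ → ι → ℝ, matrixNormalKernel A C Ψ (of Γ) * f (of Γ) =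
      ENNReal.ofReal ((√A.det ^ Fintype.card κ)⁻¹) *
        ∫⁻ Z : κ → ι → ℝ, ENNReal.ofReal (Real.exp (-(∑ k, ∑ i, Z k i ^ 2) / 2)) *
          f (C * A⁻¹ + P * of Z * Q) := by
  have hAd := hA.det_pos
  have hΨd := hΨ.det_pos
  have hP2 : P.det * P.det = Ψ.det := by rw [← det_mul, hP]
  have hQ2 : Q.det * Q.det = A.det⁻¹ := by rw [← det_mul, hQ, det_nonsing_inv, Ring.inverse_eq_inv']
  have hP0 : P.det ≠ 0 := by rintro h; rw [h] at hP2; simp at hP2; exact hΨd.ne hP2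
  have hQ0 : Q.det ≠ 0 := by
    rintro h; rw [h] at hQ2; simp at hQ2; exact hAd.ne hQ2
  have hPabs : |P.det| = √Ψ.det := by rw [← hP2, Real.sqrt_mul_self_eq_abs]
  have hQabs : |Q.det| = (√A.det)⁻¹ := by rw [← Real.sqrt_inv, ← hQ2, Real.sqrt_mul_self_eq_abs]
  have hPu : IsUnit P.det := hP0.isUnit
  have hQu : IsUnit Q.det := hQ0.isUnit
  have hmk : Measurable fun Γ : κ → ι → ℝ => matrixNormalKernel A C Ψ (of Γ) := by
    refine ENNReal.measurable_ofReal.comp (Measurable.const_mul (Real.measurable_exp.comp ?_) _)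
    exact (by fun_prop : Continuous fun Γ : κ → ι → ℝ =>
      -((of Γ - C * A⁻¹) * A * (of Γ - C * A⁻¹)ᵀ * Ψ⁻¹).trace / 2).measurable
  have hm0 : Measurable fun Γ : κ → ι → ℝ => matrixNormalKernel A C Ψ (of Γ) * f (of Γ) :=
    hmk.mul hf
  have hm1 : Measurable fun Γ : κ → ι → ℝ =>
      matrixNormalKernel A C Ψ (of Γ + C * A⁻¹) * f (of Γ + C * A⁻¹) :=
    hm0.comp (measurable_add_const (of.symm (C * A⁻¹)))
  have hcQ : Continuous fun Γ : κ → ι → ℝ => of.symm (of Γ * Q) :=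
    (by fun_prop : Continuous fun Γ : κ → ι → ℝ => of Γ * Q)
  have hm2 : Measurable fun Γ : κ → ι → ℝ =>
      matrixNormalKernel A C Ψ (of Γ * Q + C * A⁻¹) * f (of Γ * Q + C * A⁻¹) :=
    hm1.comp hcQ.measurable
  -- Substitution `Γ = C A⁻¹ + P Z Q` with symmetric roots `P` of `Ψ` and `Q` of `A⁻¹`, so that `Z`
  -- is standard Gaussian.
  calc ∫⁻ Γ : κ → ι → ℝ, matrixNormalKernel A C Ψ (of Γ) * f (of Γ)
      = ∫⁻ Γ : κ → ι → ℝ,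
          matrixNormalKernel A C Ψ (of Γ + C * A⁻¹) * f (of Γ + C * A⁻¹) :=
        (lintegral_add_right_eq_self (fun Γ : κ → ι → ℝ =>
          matrixNormalKernel A C Ψ (of Γ) * f (of Γ)) (of.symm (C * A⁻¹))).symm
    _ = ENNReal.ofReal (|Q.det| ^ Fintype.card κ) * ∫⁻ Γ : κ → ι → ℝ,
          matrixNormalKernel A C Ψ (of Γ * Q + C * A⁻¹) * f (of Γ * Q + C * A⁻¹) :=
        lintegral_mul_matrix_right _ hm1 hQ0
    _ = ENNReal.ofReal (|Q.det| ^ Fintype.card κ) * (ENNReal.ofReal (|P.det| ^ Fintype.card ι) *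
          ∫⁻ Γ : κ → ι → ℝ, matrixNormalKernel A C Ψ (P * of Γ * Q + C * A⁻¹) *
            f (P * of Γ * Q + C * A⁻¹)) := by
        rw [lintegral_mul_matrix_left _ hm2 hP0]; rfl
    _ = _ := by
        rw [hQabs, inv_pow]
        congr 1
        rw [← lintegral_const_mul' _ _ ENNReal.ofReal_ne_top]
        refine lintegral_congr fun Z => ?_
        rw [← mul_assoc, add_comm (P * of Z * Q)]
        congr 1
        rw [matrixNormalKernel, ← ENNReal.ofReal_mul (by positivity)]
        congr 1
        have htr : ((C * A⁻¹ + P * of Z * Q - C * A⁻¹) * A *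
            (C * A⁻¹ + P * of Z * Q - C * A⁻¹)ᵀ * Ψ⁻¹).trace = ∑ k, ∑ i, Z k i ^ 2 := by
          have h1 : Q * A * Q = 1 := by
            have : A = Q⁻¹ * Q⁻¹ := by
              rw [← Matrix.mul_inv_rev, hQ, nonsing_inv_nonsing_inv _ hAd.ne'.isUnit]
            rw [this, ← Matrix.mul_assoc, mul_nonsing_inv _ hQu, Matrix.one_mul,
              nonsing_inv_mul _ hQu]
          have h2 : P * Ψ⁻¹ * P = 1 := by
            rw [← hP, Matrix.mul_inv_rev, ← Matrix.mul_assoc, mul_nonsing_inv _ hPu, Matrix.one_mul,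
              nonsing_inv_mul _ hPu]
          rw [add_sub_cancel_left, transpose_mul, transpose_mul, hPT, hQT,
            show P * of Z * Q * A * (Q * ((of Z)ᵀ * P)) * Ψ⁻¹ =
              P * of Z * (Q * A * Q) * (of Z)ᵀ * (P * Ψ⁻¹) by simp only [Matrix.mul_assoc], h1,
            Matrix.mul_one, Matrix.mul_assoc P, Matrix.mul_assoc P, trace_mul_comm,
            Matrix.mul_assoc, h2, Matrix.mul_one]
          exact trace_mul_transpose_self (of Z)
        -- The Jacobian of `P` cancels the determinant in the kernel, which leaves no prefactor in
        -- `Ψ`.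
        have hdet : √Ψ.det ^ Fintype.card ι * Ψ.det ^ (-((Fintype.card ι : ℝ) / 2)) = 1 := by
          rw [Real.sqrt_eq_rpow, ← Real.rpow_natCast, ← Real.rpow_mul hΨd.le,
            ← Real.rpow_add hΨd, show (1 / 2 * (Fintype.card ι : ℝ) +
              -((Fintype.card ι : ℝ) / 2)) = 0 by ring, Real.rpow_zero]
        rw [htr, hPabs, ← mul_assoc, hdet, one_mul]

theorem dotProduct_mul_self_mulVec {x R : Matrix ι ι ℝ} (hRT : Rᵀ = R) (hR : R * R = x)
    (u : ι → ℝ) : u ⬝ᵥ x *ᵥ u = ∑ l, (R *ᵥ u) l ^ 2 := by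
  rw [← hR, ← mulVec_mulVec, dotProduct_mulVec, ← mulVec_transpose, hRT]
  simp [dotProduct, sq]

/-- In expectations, `E[Γ x Γ'] = M x M' + tr(x A⁻¹) Ψ` with `M = C A⁻¹`; this is the origin of the
trace term. With `R * R = x` the form is a sum over `l` of squares of affine functions of the
standard Gaussian `Z`. The coefficients `(P w)_k (R Q)_{l i}` have squares summing to `(w' Ψ w) tr(x
A⁻¹)`. -/
theorem lintegral_matrixNormalKernel_quadForm {A : Matrix ι ι ℝ} (hA : A.PosDef)
    (C : Matrix κ ι ℝ) {Ψ : Matrix κ κ ℝ} (hΨ : Ψ.PosDef) {x : Matrix ι ι ℝ} (hx : x.PosSemidef)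
    (a : ι → ℝ) (w : κ → ℝ) :
    ∫⁻ Γ : κ → ι → ℝ, matrixNormalKernel A C Ψ (of Γ) *
        ENNReal.ofReal ((a + (of Γ)ᵀ *ᵥ w) ⬝ᵥ x *ᵥ (a + (of Γ)ᵀ *ᵥ w)) =
      matrixNormalMass κ A * ENNReal.ofReal
        ((a + (C * A⁻¹)ᵀ *ᵥ w) ⬝ᵥ x *ᵥ (a + (C * A⁻¹)ᵀ *ᵥ w) +
          (x * A⁻¹).trace * (w ⬝ᵥ Ψ *ᵥ w)) := by
  obtain ⟨P, hPT, hP⟩ := exists_symm_sqrt hΨ.posSemidef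
  obtain ⟨Q, hQT, hQ⟩ := exists_symm_sqrt hA.inv.posSemidef
  obtain ⟨R, hRT, hR⟩ := exists_symm_sqrt hx
  have hf : Measurable fun Γ : κ → ι → ℝ =>
      ENNReal.ofReal ((a + (of Γ)ᵀ *ᵥ w) ⬝ᵥ x *ᵥ (a + (of Γ)ᵀ *ᵥ w)) :=
    ENNReal.measurable_ofReal.comp (by fun_prop : Continuous fun Γ : κ → ι → ℝ =>
      (a + (of Γ)ᵀ *ᵥ w) ⬝ᵥ x *ᵥ (a + (of Γ)ᵀ *ᵥ w)).measurable
  rw [lintegral_matrixNormalKernel_mul hA C hΨ hPT hP hQT hQ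
    (f := fun Γ => ENNReal.ofReal ((a + Γᵀ *ᵥ w) ⬝ᵥ x *ᵥ (a + Γᵀ *ᵥ w))) hf]
  set b := a + (C * A⁻¹)ᵀ *ᵥ w with hb
  have hlin : ∀ (Z : κ → ι → ℝ) l, (R *ᵥ (a + (C * A⁻¹ + P * of Z * Q)ᵀ *ᵥ w)) l =
      (R *ᵥ b) l + ∑ k, ∑ i, ((P *ᵥ w) k * (R * Q) l i) * Z k i := by
    intro Z l
    have h1 : R *ᵥ (a + (C * A⁻¹ + P * of Z * Q)ᵀ *ᵥ w) =
        R *ᵥ b + (R * Q) *ᵥ ((of Z)ᵀ *ᵥ (P *ᵥ w)) := by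
      rw [transpose_add, add_mulVec, ← add_assoc, ← hb, mulVec_add, transpose_mul, transpose_mul,
        hPT, hQT]
      simp only [mulVec_mulVec, Matrix.mul_assoc]
    rw [h1, Pi.add_apply]
    congr 1
    rw [mulVec, dotProduct, Finset.sum_comm]
    refine Finset.sum_congr rfl fun i _ => ?_
    rw [mulVec, dotProduct, Finset.mul_sum]
    refine Finset.sum_congr rfl fun k _ => ?_
    simp only [transpose_apply, of_apply]
    ring
  have hsq : ∀ Z : κ → ι → ℝ, ENNReal.ofReal ((a + (C * A⁻¹ + P * of Z * Q)ᵀ *ᵥ w) ⬝ᵥ x *ᵥ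
      (a + (C * A⁻¹ + P * of Z * Q)ᵀ *ᵥ w)) =
      ∑ l, ENNReal.ofReal (((R *ᵥ b) l + ∑ k, ∑ i, ((P *ᵥ w) k * (R * Q) l i) * Z k i) ^ 2) := by
    intro Z
    rw [dotProduct_mul_self_mulVec hRT hR, ENNReal.ofReal_sum_of_nonneg fun l _ => sq_nonneg _]
    simp_rw [hlin]
  simp_rw [hsq, Finset.mul_sum]
  rw [lintegral_finsetSum _ fun l _ => by fun_prop]
  simp_rw [lintegral_exp_mul_affine_sq_curried]
  rw [← Finset.mul_sum, ← ENNReal.ofReal_sum_of_nonneg fun l _ => by positivity, ← mul_assoc,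
    ← ENNReal.ofReal_mul (by positivity), matrixNormalMass, mul_comm (√A.det ^ _)⁻¹]
  congr 2
  rw [Finset.sum_add_distrib, dotProduct_mul_self_mulVec hRT hR,
    dotProduct_mul_self_mulVec hPT hP]
  congr 1
  have htr : (x * A⁻¹).trace = ∑ l, ∑ i, (R * Q) l i ^ 2 := by
    rw [← trace_mul_transpose_self, transpose_mul, hRT, hQT, ← hR, ← hQ, Matrix.mul_assoc R,
      trace_mul_comm R]
    simp only [Matrix.mul_assoc]
  rw [htr, Finset.sum_mul]
  refine Finset.sum_congr rfl fun l _ => ?_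
  rw [Finset.sum_mul_sum, Finset.sum_comm]
  exact Finset.sum_congr rfl fun i _ => Finset.sum_congr rfl fun k _ => by ring

/-- The mass does not depend on `Ψ`, so it comes out of the later integrals over `Ψ`. -/
theorem lintegral_matrixNormalKernel {A : Matrix ι ι ℝ} (hA : A.PosDef)
    (C : Matrix κ ι ℝ) {Ψ : Matrix κ κ ℝ} (hΨ : Ψ.PosDef) :
    ∫⁻ Γ : κ → ι → ℝ, matrixNormalKernel A C Ψ (of Γ) = matrixNormalMass κ A := by
  obtain ⟨P, hPT, hP⟩ := exists_symm_sqrt hΨ.posSemidef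
  obtain ⟨Q, hQT, hQ⟩ := exists_symm_sqrt hA.inv.posSemidef
  have h := lintegral_matrixNormalKernel_mul hA C hΨ hPT hP hQT hQ (f := fun _ => 1)
    measurable_const
  have h2 := lintegral_exp_mul_affine_sq_curried 1 (0 : κ → ι → ℝ)
  simp only [Pi.zero_apply, zero_mul, Finset.sum_const_zero, add_zero, one_pow,
    ENNReal.ofReal_one, mul_one, ne_eq, OfNat.ofNat_ne_zero, not_false_eq_true, zero_pow] at h h2
  rw [h, h2, ← ENNReal.ofReal_mul (by positivity), mul_comm, matrixNormalMass]

end MatrixNormal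

/-! ### Integrating out the second block row. -/

section BlockIntegral

open Matrix

variable {κ : Type*} [Fintype κ] [DecidableEq κ]

theorem measurable_matrixNormalKernel (A : Matrix ι ι ℝ) (C : Matrix κ ι ℝ) :
    Measurable fun p : Matrix κ κ ℝ × (κ → ι → ℝ) => matrixNormalKernel A C p.1 (of p.2) := by
  have hinv : Measurable fun p : Matrix κ κ ℝ × (κ → ι → ℝ) => p.1⁻¹ :=
    measurable_matrix_inv.comp measurable_fst
  have hdet : Measurable fun p : Matrix κ κ ℝ × (κ → ι → ℝ) => p.1.det :=
    measurable_det.comp measurable_fst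
  have htr : Measurable fun p : Matrix κ κ ℝ × (κ → ι → ℝ) =>
      ((of p.2 - C * A⁻¹) * A * (of p.2 - C * A⁻¹)ᵀ * p.1).trace :=
    (by fun_prop : Continuous fun p : Matrix κ κ ℝ × (κ → ι → ℝ) =>
      ((of p.2 - C * A⁻¹) * A * (of p.2 - C * A⁻¹)ᵀ * p.1).trace).measurable
  have htr' := htr.comp (hinv.prodMk measurable_snd)
  unfold matrixNormalKernel
  exact ENNReal.measurable_ofReal.comp ((hdet.pow_const (-((Fintype.card ι : ℝ) / 2))).mul
    (Real.measurable_exp.comp (htr'.neg.div_const 2)))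

/-- The change of variables `φ = Γ x`, `y = Ψ + Γ x Γ'`. -/
theorem lintegral_block_change {x : Matrix ι ι ℝ} (hx : xᵀ = x) (hdet : x.det ≠ 0)
    {H : (κ → ι → ℝ) → Matrix κ κ ℝ → ℝ≥0∞} (hH : Measurable (Function.uncurry H)) :
    ∫⁻ y, (∫⁻ φ : κ → ι → ℝ, H φ y) ∂symLebesgue κ =
      ∫⁻ Ψ, (∫⁻ Γ : κ → ι → ℝ, ENNReal.ofReal (|x.det| ^ Fintype.card κ) *
        H (of.symm (of Γ * x)) (Ψ + of Γ * x * (of Γ)ᵀ)) ∂symLebesgue κ := by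
  have hcx : Continuous fun Γ : κ → ι → ℝ => of.symm (of Γ * x) :=
    (by fun_prop : Continuous fun Γ : κ → ι → ℝ => of Γ * x)
  have hH' : Measurable fun p : Matrix κ κ ℝ × (κ → ι → ℝ) => H p.2 p.1 :=
    hH.comp measurable_swap
  have h1 : Measurable fun p : (κ → ι → ℝ) × Matrix κ κ ℝ => H (of.symm (of p.1 * x)) p.2 :=
    hH.comp ((hcx.measurable.comp measurable_fst).prodMk measurable_snd)
  have hshift : Continuous fun p : (κ → ι → ℝ) × Matrix κ κ ℝ =>
      (p.1, p.2 + of p.1 * x * (of p.1)ᵀ) := by fun_prop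
  have h2 : Measurable fun p : (κ → ι → ℝ) × Matrix κ κ ℝ =>
      H (of.symm (of p.1 * x)) (p.2 + of p.1 * x * (of p.1)ᵀ) := h1.comp hshift.measurable
  have h2' : Measurable fun p : Matrix κ κ ℝ × (κ → ι → ℝ) =>
      H (of.symm (of p.2 * x)) (p.1 + of p.2 * x * (of p.2)ᵀ) := h2.comp measurable_swap
  have h3 : Measurable (Function.uncurry fun (Ψ : Matrix κ κ ℝ) (Γ : κ → ι → ℝ) =>
      ENNReal.ofReal (|x.det| ^ Fintype.card κ) *
        H (of.symm (of Γ * x)) (Ψ + of Γ * x * (of Γ)ᵀ)) := h2'.const_mul _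
  -- The shift of `y` depends on `Γ`, so `y` must be the inner variable while `φ` is rescaled and
  -- `y` translated.
  rw [lintegral_lintegral_swap hH'.aemeasurable,
    lintegral_mul_matrix_right _ hH'.lintegral_prod_left' hdet,
    lintegral_lintegral_swap h3.aemeasurable,
    ← lintegral_const_mul' _ _ ENNReal.ofReal_ne_top]
  refine lintegral_congr fun Γ => ?_
  rw [lintegral_const_mul' _ _ ENNReal.ofReal_ne_top]
  congr 1
  exact (lintegral_symLebesgue_add_right _ (h1.comp measurable_prodMk_left) (by
      simp [transpose_mul, hx, Matrix.mul_assoc])).symm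

theorem invWishartKernel_ne_top (d : ℝ) (D M : Matrix ι ι ℝ) : invWishartKernel d D M ≠ ∞ := by
  unfold invWishartKernel
  split_ifs <;> simp

/-- Integration of the inverse Wishart kernel over the second block row, in the coordinates
`Γ = φ x⁻¹`, `Ψ = y - φ x⁻¹ φ'`. -/
theorem lintegral_invWishartKernel_block (d : ℝ) {x : Matrix ι ι ℝ} (hx : x.PosDef)
    {A : Matrix ι ι ℝ} (hA : A.PosDef) (C : Matrix κ ι ℝ) (E : Matrix κ κ ℝ)
    {G : (κ → ι → ℝ) → Matrix κ κ ℝ → ℝ≥0∞} (hG : Measurable (Function.uncurry G)) :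
    ∫⁻ y, (∫⁻ φ : κ → ι → ℝ, invWishartKernel d (fromBlocks A Cᵀ C E)
        (fromBlocks x (of φ)ᵀ (of φ) y) * G φ y) ∂symLebesgue κ =
      ∫⁻ Ψ, (invWishartKernel d A x *
        invWishartKernel (d + Fintype.card ι) (E - C * A⁻¹ * Cᵀ) Ψ) *
          (∫⁻ Γ : κ → ι → ℝ, matrixNormalKernel A C Ψ (of Γ) *
            G (of.symm (of Γ * x)) (Ψ + of Γ * x * (of Γ)ᵀ)) ∂symLebesgue κ := by
  have hxT : xᵀ = x := by simpa using hx.isHermitian.eq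
  have hH : Measurable (Function.uncurry fun (φ : κ → ι → ℝ) (y : Matrix κ κ ℝ) =>
      invWishartKernel d (fromBlocks A Cᵀ C E) (fromBlocks x (of φ)ᵀ (of φ) y) * G φ y) := by
    refine Measurable.mul ?_ hG
    have h := (measurable_invWishartKernel d (fromBlocks A Cᵀ C E)).comp
        (measurable_fromBlocks (measurable_const (a := x))
          (measurable_snd (α := κ → ι → ℝ) (β := Matrix κ κ ℝ)) measurable_fst)
    exact h
  rw [lintegral_block_change hxT hx.det_pos.ne' hH]
  refine lintegral_congr fun Ψ => ?_
  have hne : invWishartKernel d A x *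
        invWishartKernel (d + Fintype.card ι) (E - C * A⁻¹ * Cᵀ) Ψ ≠ ∞ :=
    ENNReal.mul_ne_top (invWishartKernel_ne_top _ _ _) (invWishartKernel_ne_top _ _ _)
  rw [← lintegral_const_mul' _ _ hne]
  refine lintegral_congr fun Γ => ?_
  rw [abs_of_pos hx.det_pos, ← mul_assoc, ← mul_assoc]
  congr 1
  rw [mul_assoc (invWishartKernel d A x)]
  exact invWishartKernel_block d hx (of Γ) Ψ hA C E

theorem lintegral_invWishartKernel_block_one (d : ℝ) {x : Matrix ι ι ℝ} (hx : x.PosDef)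
    {A : Matrix ι ι ℝ} (hA : A.PosDef) (C : Matrix κ ι ℝ) (E : Matrix κ κ ℝ) :
    ∫⁻ y, (∫⁻ φ : κ → ι → ℝ, invWishartKernel d (fromBlocks A Cᵀ C E)
        (fromBlocks x (of φ)ᵀ (of φ) y)) ∂symLebesgue κ =
      matrixNormalMass κ A * invWishartKernel d A x *
        ∫⁻ Ψ, invWishartKernel (d + Fintype.card ι) (E - C * A⁻¹ * Cᵀ) Ψ ∂symLebesgue κ := by
  have h := lintegral_invWishartKernel_block d hx hA C E (G := fun _ _ => 1) measurable_const
  simp only [mul_one] at h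
  rw [h, ← lintegral_const_mul _ (measurable_invWishartKernel _ _)]
  refine lintegral_congr fun Ψ => ?_
  by_cases hΨ : Ψ.PosDef
  · rw [lintegral_matrixNormalKernel hA C hΨ]; ring
  · simp [invWishartKernel_of_not_posDef _ _ hΨ]

theorem trace_mul_nonneg_of_posSemidef {x y : Matrix ι ι ℝ} (hx : x.PosSemidef)
    (hy : y.PosSemidef) : 0 ≤ (x * y).trace := by
  obtain ⟨R, hRT, hR⟩ := exists_symm_sqrt hx
  rw [← hR, Matrix.mul_assoc, trace_mul_comm]
  have h := (hy.mul_mul_conjTranspose_same R).trace_nonneg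
  rwa [conjTranspose_eq_transpose_of_trivial, hRT] at h

theorem dotProduct_block_mulVec {x : Matrix ι ι ℝ} (hx : xᵀ = x) (Γ : Matrix κ ι ℝ)
    (Ψ : Matrix κ κ ℝ) (a : ι → ℝ) (w : κ → ℝ) :
    Sum.elim a w ⬝ᵥ fromBlocks x (Γ * x)ᵀ (Γ * x) (Ψ + Γ * x * Γᵀ) *ᵥ Sum.elim a w =
      w ⬝ᵥ Ψ *ᵥ w + (a + Γᵀ *ᵥ w) ⬝ᵥ x *ᵥ (a + Γᵀ *ᵥ w) := by
  rw [fromBlocks_mulVec, sumElim_dotProduct_sumElim]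
  simp only [transpose_mul, hx, add_mulVec, mulVec_add, dotProduct_add, add_dotProduct,
    ← mulVec_mulVec, Sum.elim_comp_inl, Sum.elim_comp_inr, dotProduct_mulVec w Γ,
    ← mulVec_transpose Γ]
  ring

/-- The form equals `w' Ψ w` plus the form of `x` at `a + Γ' w`. The Gaussian spread of `Γ`
contributes another `tr(x A⁻¹) w' Ψ w`, hence the factor `1 + tr(x A⁻¹)`. A general `a` serves the
induction on the dimension; `a = 0` gives the transition mean. -/
theorem lintegral_invWishartKernel_block_quadForm (d : ℝ) {x : Matrix ι ι ℝ} (hx : x.PosDef)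
    {A : Matrix ι ι ℝ} (hA : A.PosDef) (C : Matrix κ ι ℝ) (E : Matrix κ κ ℝ)
    (a : ι → ℝ) (w : κ → ℝ) :
    ∫⁻ y, (∫⁻ φ : κ → ι → ℝ, invWishartKernel d (fromBlocks A Cᵀ C E)
        (fromBlocks x (of φ)ᵀ (of φ) y) * ENNReal.ofReal
          (Sum.elim a w ⬝ᵥ fromBlocks x (of φ)ᵀ (of φ) y *ᵥ Sum.elim a w)) ∂symLebesgue κ =
      matrixNormalMass κ A * invWishartKernel d A x *
        (ENNReal.ofReal (1 + (x * A⁻¹).trace) *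
            (∫⁻ Ψ, invWishartKernel (d + Fintype.card ι) (E - C * A⁻¹ * Cᵀ) Ψ *
              ENNReal.ofReal (w ⬝ᵥ Ψ *ᵥ w) ∂symLebesgue κ) +
          ENNReal.ofReal ((a + (C * A⁻¹)ᵀ *ᵥ w) ⬝ᵥ x *ᵥ (a + (C * A⁻¹)ᵀ *ᵥ w)) *
            ∫⁻ Ψ, invWishartKernel (d + Fintype.card ι) (E - C * A⁻¹ * Cᵀ) Ψ ∂symLebesgue κ) := by
  have hxT : xᵀ = x := by simpa using hx.isHermitian.eq
  have hG : Measurable (Function.uncurry fun (φ : κ → ι → ℝ) (y : Matrix κ κ ℝ) => ENNReal.ofReal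
      (Sum.elim a w ⬝ᵥ fromBlocks x (of φ)ᵀ (of φ) y *ᵥ Sum.elim a w)) := by
    have h : Continuous fun p : (κ → ι → ℝ) × Matrix κ κ ℝ =>
      Sum.elim a w ⬝ᵥ fromBlocks x (of p.1)ᵀ (of p.1) p.2 *ᵥ Sum.elim a w := by fun_prop
    exact ENNReal.measurable_ofReal.comp h.measurable
  have hq : Measurable fun Ψ : Matrix κ κ ℝ => ENNReal.ofReal (w ⬝ᵥ Ψ *ᵥ w) :=
    ENNReal.measurable_ofReal.comp
      (by fun_prop : Continuous fun Ψ : Matrix κ κ ℝ => w ⬝ᵥ Ψ *ᵥ w).measurable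
  rw [lintegral_invWishartKernel_block d hx hA C E hG]
  have hne : ∀ Ψ : Matrix κ κ ℝ, Measurable fun Γ : κ → ι → ℝ =>
      matrixNormalKernel A C Ψ (of Γ) := fun Ψ => by
    have h := (measurable_matrixNormalKernel A C).comp (measurable_prodMk_left (x := Ψ))
    exact h
  have hk : Measurable fun Ψ : Matrix κ κ ℝ =>
      invWishartKernel (d + Fintype.card ι) (E - C * A⁻¹ * Cᵀ) Ψ := measurable_invWishartKernel _ _
  have hkq : Measurable fun Ψ : Matrix κ κ ℝ =>
      invWishartKernel (d + Fintype.card ι) (E - C * A⁻¹ * Cᵀ) Ψ *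
        ENNReal.ofReal (w ⬝ᵥ Ψ *ᵥ w) := hk.mul hq
  rw [← lintegral_const_mul _ hkq, ← lintegral_const_mul _ hk,
    ← lintegral_add_left (hkq.const_mul _),
    ← lintegral_const_mul' _ _ (ENNReal.mul_ne_top matrixNormalMass_ne_top
      (invWishartKernel_ne_top _ _ _))]
  refine lintegral_congr fun Ψ => ?_
  by_cases hΨ : Ψ.PosDef
  swap
  · simp [invWishartKernel_of_not_posDef _ _ hΨ]
  have hxq : ∀ u : ι → ℝ, 0 ≤ u ⬝ᵥ x *ᵥ u := fun u => by
    simpa using hx.posSemidef.dotProduct_mulVec_nonneg u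
  have hΨq : 0 ≤ w ⬝ᵥ Ψ *ᵥ w := by simpa using hΨ.posSemidef.dotProduct_mulVec_nonneg w
  have htr : 0 ≤ (x * A⁻¹).trace := trace_mul_nonneg_of_posSemidef hx.posSemidef hA.inv.posSemidef
  have hpt : ∀ Γ : κ → ι → ℝ, matrixNormalKernel A C Ψ (of Γ) * ENNReal.ofReal
      (Sum.elim a w ⬝ᵥ fromBlocks x (of (of.symm (of Γ * x)))ᵀ (of (of.symm (of Γ * x)))
        (Ψ + of Γ * x * (of Γ)ᵀ) *ᵥ Sum.elim a w) =
      matrixNormalKernel A C Ψ (of Γ) * ENNReal.ofReal (w ⬝ᵥ Ψ *ᵥ w) +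
      matrixNormalKernel A C Ψ (of Γ) * ENNReal.ofReal
        ((a + (of Γ)ᵀ *ᵥ w) ⬝ᵥ x *ᵥ (a + (of Γ)ᵀ *ᵥ w)) := by
    intro Γ
    rw [← mul_add, ← ENNReal.ofReal_add hΨq (hxq _), ← dotProduct_block_mulVec hxT]
    rfl
  simp_rw [hpt]
  rw [lintegral_add_left ((hne Ψ).mul_const _), lintegral_mul_const _ (hne Ψ),
    lintegral_matrixNormalKernel hA C hΨ,
    lintegral_matrixNormalKernel_quadForm hA C hΨ hx.posSemidef,
    ENNReal.ofReal_add (hxq _) (mul_nonneg htr hΨq), ENNReal.ofReal_mul htr,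
    ENNReal.ofReal_add zero_le_one htr, ENNReal.ofReal_one]
  ring

end BlockIntegral

/-! ### Inverse Wishart mass and mean: the induction step over blocks. -/

section Moments

open Matrix

variable {κ : Type*} [Fintype κ] [DecidableEq κ]

theorem posDef_of_fromBlocks {A : Matrix ι ι ℝ} {C : Matrix κ ι ℝ} {E : Matrix κ κ ℝ}
    (h : (fromBlocks A Cᵀ C E).PosDef) : A.PosDef ∧ E.PosDef :=
  ⟨h.submatrix (e := Sum.inl) Sum.inl_injective, h.submatrix (e := Sum.inr) Sum.inr_injective⟩

theorem fromBlocks_eq_block {A : Matrix ι ι ℝ} (hA : A.PosDef) (C : Matrix κ ι ℝ)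
    (E : Matrix κ κ ℝ) : fromBlocks A Cᵀ C E =
      fromBlocks A (C * A⁻¹ * A)ᵀ (C * A⁻¹ * A)
        (E - C * A⁻¹ * Cᵀ + C * A⁻¹ * A * (C * A⁻¹)ᵀ) := by
  have hAT : Aᵀ = A := by simpa using hA.isHermitian.eq
  have h1 : C * A⁻¹ * A = C := by
    rw [Matrix.mul_assoc, nonsing_inv_mul _ hA.det_pos.ne'.isUnit, Matrix.mul_one]
  rw [h1, transpose_mul, transpose_nonsing_inv, hAT, Matrix.mul_assoc, sub_add_cancel]

theorem posDef_fromBlocks_iff {A : Matrix ι ι ℝ} (hA : A.PosDef) (C : Matrix κ ι ℝ)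
    (E : Matrix κ κ ℝ) :
    (fromBlocks A Cᵀ C E).PosDef ↔ (E - C * A⁻¹ * Cᵀ).PosDef := by
  rw [fromBlocks_eq_block hA, posDef_block_iff hA]

theorem exists_eq_fromBlocks {D : Matrix (ι ⊕ κ) (ι ⊕ κ) ℝ} (hD : D.PosDef) :
    ∃ (A : Matrix ι ι ℝ) (C : Matrix κ ι ℝ) (E : Matrix κ κ ℝ), D = fromBlocks A Cᵀ C E := by
  refine ⟨D.toBlocks₁₁, D.toBlocks₂₁, D.toBlocks₂₂, ?_⟩
  have hDT : Dᵀ = D := by simpa using hD.isHermitian.eq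
  have h : D.toBlocks₁₂ = D.toBlocks₂₁ᵀ := by
    ext i j
    exact congrFun (congrFun hDT.symm (Sum.inl i)) (Sum.inr j)
  rw [← h, fromBlocks_toBlocks]

theorem measurable_quadForm (w : ι → ℝ) :
    Measurable fun M : Matrix ι ι ℝ => ENNReal.ofReal (w ⬝ᵥ M *ᵥ w) :=
  ENNReal.measurable_ofReal.comp
    (by fun_prop : Continuous fun M : Matrix ι ι ℝ => w ⬝ᵥ M *ᵥ w).measurable

/-- Reduces trace moments to moments of quadratic forms. The vectors are the rows of a symmetric
root of `B`. -/
theorem exists_trace_eq_sum_quadForm {B : Matrix ι ι ℝ} (hB : B.PosSemidef) :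
    ∃ v : ι → ι → ℝ, ∀ x : Matrix ι ι ℝ, (x * B).trace = ∑ l, v l ⬝ᵥ x *ᵥ v l := by
  obtain ⟨R, hRT, hR⟩ := exists_symm_sqrt hB
  refine ⟨R, fun x => ?_⟩
  rw [← hR, ← Matrix.mul_assoc, trace_mul_comm, ← Matrix.mul_assoc]
  refine Finset.sum_congr rfl fun l _ => ?_
  have hs : ∀ k, R k l = R l k := fun k => congrFun (congrFun hRT l) k
  rw [diag_apply, Matrix.mul_assoc, Matrix.mul_apply]
  simp only [dotProduct, mulVec, Matrix.mul_apply, hs]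

/-- The inverse Wishart kernel has positive and finite mass for all `d > 0`, and its quadratic
forms have the mean `w' D w / (d - 2)` for `d > 2`. -/
def HasInvWishartMoments (ι : Type*) [Fintype ι] [DecidableEq ι] : Prop :=
  ∀ (d : ℝ) (D : Matrix ι ι ℝ), D.PosDef →
    (0 < d → ∫⁻ M, invWishartKernel d D M ∂symLebesgue ι ≠ 0 ∧
      ∫⁻ M, invWishartKernel d D M ∂symLebesgue ι ≠ ∞) ∧
    (2 < d → ∀ w : ι → ℝ,
      ∫⁻ M, invWishartKernel d D M * ENNReal.ofReal (w ⬝ᵥ M *ᵥ w) ∂symLebesgue ι =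
        ENNReal.ofReal (w ⬝ᵥ D *ᵥ w / (d - 2)) * ∫⁻ M, invWishartKernel d D M ∂symLebesgue ι)

theorem quadForm_nonneg {M : Matrix ι ι ℝ} (hM : M.PosSemidef) (w : ι → ℝ) :
    0 ≤ w ⬝ᵥ M *ᵥ w := by
  simpa using hM.dotProduct_mulVec_nonneg w

theorem measurable_trace_mul (B : Matrix ι ι ℝ) :
    Measurable fun M : Matrix ι ι ℝ => ENNReal.ofReal (M * B).trace :=
  ENNReal.measurable_ofReal.comp
    (by fun_prop : Continuous fun M : Matrix ι ι ℝ => (M * B).trace).measurable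

theorem HasInvWishartMoments.lintegral_trace (hι : HasInvWishartMoments ι) {d : ℝ} (hd : 2 < d)
    {D : Matrix ι ι ℝ} (hD : D.PosDef) {B : Matrix ι ι ℝ} (hB : B.PosSemidef) :
    ∫⁻ M, invWishartKernel d D M * ENNReal.ofReal (M * B).trace ∂symLebesgue ι =
      ENNReal.ofReal ((D * B).trace / (d - 2)) * ∫⁻ M, invWishartKernel d D M ∂symLebesgue ι := by
  obtain ⟨v, hv⟩ := exists_trace_eq_sum_quadForm hB
  have hpt : ∀ M, invWishartKernel d D M * ENNReal.ofReal (M * B).trace =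
      ∑ l, invWishartKernel d D M * ENNReal.ofReal (v l ⬝ᵥ M *ᵥ v l) := by
    intro M
    by_cases hM : M.PosDef
    · rw [hv, ENNReal.ofReal_sum_of_nonneg fun l _ => quadForm_nonneg hM.posSemidef _,
        Finset.mul_sum]
    · simp [invWishartKernel_of_not_posDef _ _ hM]
  simp_rw [hpt]
  have hm : ∀ l, Measurable fun M : Matrix ι ι ℝ =>
      invWishartKernel d D M * ENNReal.ofReal (v l ⬝ᵥ M *ᵥ v l) := fun l =>
    (measurable_invWishartKernel _ _).mul (measurable_quadForm _)
  rw [lintegral_finsetSum _ fun l _ => hm l, hv, Finset.sum_div, ENNReal.ofReal_sum_of_nonneg fun l _ =>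
      div_nonneg (quadForm_nonneg hD.posSemidef _) (by linarith), Finset.sum_mul]
  exact Finset.sum_congr rfl fun l _ => (hι d D hD).2 hd (v l)

theorem lintegral_invWishartKernel_sum (d : ℝ) {A : Matrix ι ι ℝ} (hA : A.PosDef)
    (C : Matrix κ ι ℝ) (E : Matrix κ κ ℝ) :
    ∫⁻ M, invWishartKernel d (fromBlocks A Cᵀ C E) M ∂symLebesgue (ι ⊕ κ) =
      matrixNormalMass κ A * (∫⁻ x, invWishartKernel d A x ∂symLebesgue ι) *
        ∫⁻ Ψ, invWishartKernel (d + Fintype.card ι) (E - C * A⁻¹ * Cᵀ) Ψ ∂symLebesgue κ := by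
  rw [lintegral_symLebesgue_sum _ (measurable_invWishartKernel _ _),
    ← lintegral_const_mul' _ _ matrixNormalMass_ne_top,
    ← lintegral_mul_const _ ((measurable_invWishartKernel _ _).const_mul _)]
  refine lintegral_congr fun x => ?_
  by_cases hx : x.PosDef
  · exact lintegral_invWishartKernel_block_one d hx hA C E
  · rw [invWishartKernel_of_not_posDef _ _ hx, mul_zero, zero_mul]
    simp_rw [invWishartKernel_of_not_posDef _ _ fun h => hx (posDef_of_fromBlocks h).1]
    simp

theorem lintegral_invWishartKernel_sum_quadForm (d : ℝ) {A : Matrix ι ι ℝ} (hA : A.PosDef)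
    (C : Matrix κ ι ℝ) (E : Matrix κ κ ℝ) (a : ι → ℝ) (w : κ → ℝ) :
    ∫⁻ M, invWishartKernel d (fromBlocks A Cᵀ C E) M *
        ENNReal.ofReal (Sum.elim a w ⬝ᵥ M *ᵥ Sum.elim a w) ∂symLebesgue (ι ⊕ κ) =
      ∫⁻ x, matrixNormalMass κ A * invWishartKernel d A x *
        (ENNReal.ofReal (1 + (x * A⁻¹).trace) *
            (∫⁻ Ψ, invWishartKernel (d + Fintype.card ι) (E - C * A⁻¹ * Cᵀ) Ψ *
              ENNReal.ofReal (w ⬝ᵥ Ψ *ᵥ w) ∂symLebesgue κ) +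
          ENNReal.ofReal ((a + (C * A⁻¹)ᵀ *ᵥ w) ⬝ᵥ x *ᵥ (a + (C * A⁻¹)ᵀ *ᵥ w)) *
            ∫⁻ Ψ, invWishartKernel (d + Fintype.card ι) (E - C * A⁻¹ * Cᵀ) Ψ ∂symLebesgue κ)
          ∂symLebesgue ι := by
  have hm : Measurable fun M : Matrix (ι ⊕ κ) (ι ⊕ κ) ℝ =>
      invWishartKernel d (fromBlocks A Cᵀ C E) M *
        ENNReal.ofReal (Sum.elim a w ⬝ᵥ M *ᵥ Sum.elim a w) :=
    (measurable_invWishartKernel _ _).mul (measurable_quadForm _)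
  rw [lintegral_symLebesgue_sum _ hm]
  refine lintegral_congr fun x => ?_
  by_cases hx : x.PosDef
  · exact lintegral_invWishartKernel_block_quadForm d hx hA C E a w
  · rw [invWishartKernel_of_not_posDef _ _ hx, mul_zero, zero_mul]
    simp_rw [invWishartKernel_of_not_posDef _ _ fun h => hx (posDef_of_fromBlocks h).1]
    simp

/-- In block coordinates the mass is a product. For the mean, the hypothesis on `κ` is used with `d
+ card ι` degrees of freedom for `Ψ`, and that on `ι` with `d` for the trace and the quadratic form
in `x`. -/
theorem HasInvWishartMoments.sum (hι : HasInvWishartMoments ι) (hκ : HasInvWishartMoments κ) :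
    HasInvWishartMoments (ι ⊕ κ) := by
  intro d D hD
  obtain ⟨A, C, E, rfl⟩ := exists_eq_fromBlocks hD
  have hA := (posDef_of_fromBlocks hD).1
  have hV := (posDef_fromBlocks_iff hA C E).1 hD
  have hcard : (0 : ℝ) ≤ Fintype.card ι := Nat.cast_nonneg _
  refine ⟨fun hd => ?_, fun hd v => ?_⟩
  · rw [lintegral_invWishartKernel_sum d hA]
    have h1 := (hι d A hA).1 hd
    have h2 := (hκ (d + Fintype.card ι) _ hV).1 (by linarith)
    exact ⟨mul_ne_zero (mul_ne_zero (matrixNormalMass_ne_zero hA) h1.1) h2.1,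
      ENNReal.mul_ne_top (ENNReal.mul_ne_top matrixNormalMass_ne_top h1.2) h2.2⟩
  · obtain ⟨a, w, rfl⟩ : ∃ a w, v = Sum.elim a w := ⟨v ∘ Sum.inl, v ∘ Sum.inr, by simp⟩
    rw [lintegral_invWishartKernel_sum d hA, lintegral_invWishartKernel_sum_quadForm d hA,
      (hκ _ _ hV).2 (by linarith)]
    set V := E - C * A⁻¹ * Cᵀ
    set p : ℝ := (Fintype.card ι : ℝ)
    set u := a + (C * A⁻¹)ᵀ *ᵥ w
    set m := matrixNormalMass κ A
    set Zκ := ∫⁻ Ψ, invWishartKernel (d + p) V Ψ ∂symLebesgue κ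
    set c := w ⬝ᵥ V *ᵥ w / (d + p - 2)
    have hc : 0 ≤ c := div_nonneg (quadForm_nonneg hV.posSemidef _) (by linarith)
    have hpt : ∀ x, m * invWishartKernel d A x * (ENNReal.ofReal (1 + (x * A⁻¹).trace) *
        (ENNReal.ofReal c * Zκ) + ENNReal.ofReal (u ⬝ᵥ x *ᵥ u) * Zκ) =
        (m * Zκ * ENNReal.ofReal c) * invWishartKernel d A x +
        ((m * Zκ * ENNReal.ofReal c) *
          (invWishartKernel d A x * ENNReal.ofReal (x * A⁻¹).trace) +
        (m * Zκ) * (invWishartKernel d A x * ENNReal.ofReal (u ⬝ᵥ x *ᵥ u))) := by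
      intro x
      by_cases hx : x.PosDef
      · rw [ENNReal.ofReal_add zero_le_one
          (trace_mul_nonneg_of_posSemidef hx.posSemidef hA.inv.posSemidef), ENNReal.ofReal_one]
        ring
      · simp [invWishartKernel_of_not_posDef _ _ hx]
    have hk : Measurable fun x : Matrix ι ι ℝ => invWishartKernel d A x :=
      measurable_invWishartKernel _ _
    have hkt : Measurable fun x : Matrix ι ι ℝ =>
        invWishartKernel d A x * ENNReal.ofReal (x * A⁻¹).trace := hk.mul (measurable_trace_mul _)
    have hkq : Measurable fun x : Matrix ι ι ℝ =>
        invWishartKernel d A x * ENNReal.ofReal (u ⬝ᵥ x *ᵥ u) := hk.mul (measurable_quadForm _)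
    simp_rw [hpt]
    rw [lintegral_add_left (hk.const_mul _), lintegral_add_left (hkt.const_mul _),
      lintegral_const_mul _ hk, lintegral_const_mul _ hkt, lintegral_const_mul _ hkq,
      hι.lintegral_trace hd hA hA.inv.posSemidef, (hι d A hA).2 hd u,
      mul_nonsing_inv _ hA.det_pos.ne'.isUnit, trace_one]
    have hd2 : d - 2 ≠ 0 := by linarith
    have hdp : d + p - 2 ≠ 0 := by linarith
    -- Rests on `(1 + p/(d-2)) / (d+p-2) = 1/(d-2)`: the trace term exactly compensates the extra
    -- `p` degrees of freedom of `Ψ`.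
    have htot : Sum.elim a w ⬝ᵥ fromBlocks A Cᵀ C E *ᵥ Sum.elim a w / (d - 2) =
        c + (c * (p / (d - 2)) + u ⬝ᵥ A *ᵥ u / (d - 2)) := by
      rw [fromBlocks_eq_block hA, dotProduct_block_mulVec (by simpa using hA.isHermitian.eq)]
      simp only [c, u, V]
      field_simp
      ring
    have hp2 : 0 ≤ p / (d - 2) := div_nonneg hcard (by linarith)
    have hu2 : 0 ≤ u ⬝ᵥ A *ᵥ u / (d - 2) :=
      div_nonneg (quadForm_nonneg hA.posSemidef _) (by linarith)
    rw [htot, ENNReal.ofReal_add hc (add_nonneg (mul_nonneg hc hp2) hu2),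
      ENNReal.ofReal_add (mul_nonneg hc hp2) hu2, ENNReal.ofReal_mul hc]
    ring

/-- The action of an equivalence on unordered pairs. -/
def sym2Congr {α β : Type*} (e : α ≃ β) : Sym2 α ≃ Sym2 β where
  toFun := Sym2.map e
  invFun := Sym2.map e.symm
  left_inv p := by induction p using Sym2.ind; simp
  right_inv p := by induction p using Sym2.ind; simp

theorem lintegral_symLebesgue_equiv (e : ι ≃ κ) {f : Matrix κ κ ℝ → ℝ≥0∞} (hf : Measurable f) :
    ∫⁻ M, f M ∂symLebesgue κ = ∫⁻ M, f (M.submatrix e.symm e.symm) ∂symLebesgue ι := by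
  have hsub : Measurable fun M : Matrix ι ι ℝ => f (M.submatrix e.symm e.symm) :=
    hf.comp (by fun_prop : Continuous fun M : Matrix ι ι ℝ => M.submatrix e.symm e.symm).measurable
  rw [symLebesgue, lintegral_map hf (by fun_prop), symLebesgue, lintegral_map hsub (by fun_prop),
    ← (volume_measurePreserving_piCongrLeft (fun _ => ℝ) (sym2Congr e)).lintegral_comp
      (f := fun z => f (symMat z)) (hf.comp measurable_symMat)]
  refine lintegral_congr fun z => ?_
  have key : ∀ j, (MeasurableEquiv.piCongrLeft (fun _ => ℝ) (sym2Congr e)) z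
      (sym2Congr e j) = z j := fun j => Equiv.piCongrLeft_apply_apply (fun _ => ℝ) _ z j
  congr 1
  ext i j
  have := key s(e.symm i, e.symm j)
  simpa [symMat, sym2Congr] using this

theorem posDef_submatrix_equiv (e : κ ≃ ι) {M : Matrix ι ι ℝ} :
    (M.submatrix e e).PosDef ↔ M.PosDef :=
  ⟨fun h => by simpa using h.submatrix (e := e.symm) e.symm.injective,
    fun h => h.submatrix e.injective⟩

theorem invWishartKernel_submatrix (e : κ ≃ ι) (d : ℝ) (D M : Matrix ι ι ℝ) :
    invWishartKernel d (D.submatrix e e) (M.submatrix e e) = invWishartKernel d D M := by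
  have htr : ((D * M⁻¹).submatrix e e).trace = (D * M⁻¹).trace :=
    Equiv.sum_comp e fun i => (D * M⁻¹) i i
  unfold invWishartKernel
  simp only [det_submatrix_equiv_self, inv_submatrix_equiv, submatrix_mul_equiv,
    Fintype.card_congr e, htr]
  by_cases hM : M.PosDef
  · rw [if_pos hM, if_pos ((posDef_submatrix_equiv e).2 hM)]
  · rw [if_neg hM, if_neg (mt (posDef_submatrix_equiv e).1 hM)]

theorem HasInvWishartMoments.of_equiv (e : ι ≃ κ) (hι : HasInvWishartMoments ι) :
    HasInvWishartMoments κ := by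
  intro d D hD
  have hZ : ∫⁻ M, invWishartKernel d D M ∂symLebesgue κ =
      ∫⁻ M, invWishartKernel d (D.submatrix e e) M ∂symLebesgue ι := by
    rw [lintegral_symLebesgue_equiv e (measurable_invWishartKernel _ _)]
    refine lintegral_congr fun M => ?_
    rw [← invWishartKernel_submatrix e]
    simp
  have hD' := (posDef_submatrix_equiv e).2 hD
  rw [hZ]
  refine ⟨(hι d _ hD').1, fun hd w => ?_⟩
  have hm : Measurable fun M : Matrix κ κ ℝ =>
    invWishartKernel d D M * ENNReal.ofReal (w ⬝ᵥ M *ᵥ w) :=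
    (measurable_invWishartKernel _ _).mul (measurable_quadForm _)
  have h := (hι d _ hD').2 hd (w ∘ e)
  have hq : ∀ M : Matrix κ κ ℝ, (w ∘ e) ⬝ᵥ M.submatrix e e *ᵥ (w ∘ e) = w ⬝ᵥ M *ᵥ w := by
    intro M
    rw [submatrix_mulVec_equiv, Function.comp_assoc, Equiv.self_comp_symm, Function.comp_id]
    exact Equiv.sum_comp e fun i => w i * (M *ᵥ w) i
  rw [hq] at h
  rw [← h, lintegral_symLebesgue_equiv e hm]
  refine lintegral_congr fun M => ?_
  rw [← invWishartKernel_submatrix e, ← hq]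
  simp

theorem HasInvWishartMoments.of_isEmpty [IsEmpty ι] : HasInvWishartMoments ι := by
  intro d D _
  have hK : ∀ M : Matrix ι ι ℝ, invWishartKernel d D M = 1 := by
    intro M
    have : M.PosDef := by rw [Subsingleton.elim M 1]; exact PosDef.one
    rw [invWishartKernel, if_pos this]
    simp [Matrix.trace]
  have hZ : ∫⁻ M, invWishartKernel d D M ∂symLebesgue ι = 1 := by
    simp_rw [hK]
    rw [lintegral_one, symLebesgue, Measure.map_apply measurable_symMat .univ]
    simp [volume_pi]
  rw [hZ]
  exact ⟨fun _ => by simp, fun _ w => by simp [dotProduct]⟩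

end Moments

/-! ### The inverse gamma law and the end of the induction. -/

section OneDimensional

open Matrix

/-- The substitution `t ↦ t⁻¹` (the power `p = -1`) turns it into the gamma integral. -/
theorem integral_inverse_gamma {a b : ℝ} (ha : 0 < a) (hb : 0 < b) :
    ∫ t in Set.Ioi (0 : ℝ), t ^ (-(a + 1)) * Real.exp (-(b * t⁻¹)) =
      (1 / b) ^ a * Real.Gamma a := by
  rw [← Real.integral_rpow_mul_exp_neg_mul_Ioi ha hb,
    ← integral_comp_rpow_Ioi (fun t : ℝ => t ^ (a - 1) * Real.exp (-(b * t))) (p := -1)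
      (by norm_num)]
  refine setIntegral_congr_fun measurableSet_Ioi fun t ht => ?_
  have ht : (0 : ℝ) < t := ht
  simp only [smul_eq_mul]
  rw [Real.rpow_neg_one, Real.inv_rpow ht.le, ← Real.rpow_neg ht.le, abs_neg, abs_one, one_mul,
    ← mul_assoc, ← Real.rpow_add ht]
  congr 2
  ring

theorem lintegral_inverse_gamma {a b : ℝ} (ha : 0 < a) (hb : 0 < b) :
    ∫⁻ t in Set.Ioi (0 : ℝ), ENNReal.ofReal (t ^ (-(a + 1)) * Real.exp (-(b * t⁻¹))) =
      ENNReal.ofReal ((1 / b) ^ a * Real.Gamma a) := by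
  have hpos : 0 < (1 / b) ^ a * Real.Gamma a := by
    have := Real.Gamma_pos_of_pos ha
    positivity
  rw [← integral_inverse_gamma ha hb, ofReal_integral_eq_lintegral_ofReal]
  -- A nonintegrable function would have Bochner integral `0`, against the positive value just
  -- computed.
  · by_contra h
    have h1 := integral_inverse_gamma ha hb
    rw [integral_undef h] at h1
    exact hpos.ne h1
  · refine (ae_restrict_iff' measurableSet_Ioi).2 (ae_of_all _ fun t ht => ?_)
    have ht : (0 : ℝ) < t := ht
    positivity

theorem lintegral_symLebesgue_unit {f : Matrix Unit Unit ℝ → ℝ≥0∞} (hf : Measurable f) :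
    ∫⁻ M, f M ∂symLebesgue Unit = ∫⁻ t : ℝ, f (of fun _ _ => t) := by
  have h : MeasurePreserving (MeasurableEquiv.funUnique (Sym2 Unit) ℝ).symm
      volume volume := by
    convert! (volume_preserving_funUnique (Sym2 Unit) ℝ).symm
  rw [symLebesgue, lintegral_map hf (by fun_prop), ← h.lintegral_comp
      (f := fun z => f (symMat z)) (hf.comp measurable_symMat)]
  rfl

theorem posDef_unit_iff (t : ℝ) : (of fun _ _ => t : Matrix Unit Unit ℝ).PosDef ↔ 0 < t := by
  rw [show (of fun _ _ => t : Matrix Unit Unit ℝ) = diagonal fun _ => t by ext; simp,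
    posDef_diagonal_iff]
  simp

theorem invWishartKernel_unit (d : ℝ) (D : Matrix Unit Unit ℝ) {t : ℝ} (ht : 0 < t) :
    invWishartKernel d D (of fun _ _ => t) =
      ENNReal.ofReal (t ^ (-(d / 2 + 1)) * Real.exp (-(D () () / 2 * t⁻¹))) := by
  rw [invWishartKernel, if_pos ((posDef_unit_iff t).2 ht)]
  have hinv : (of fun _ _ => t : Matrix Unit Unit ℝ)⁻¹ = of fun _ _ => t⁻¹ := by
    refine inv_eq_right_inv ?_
    ext i j
    simp [Matrix.mul_apply, ht.ne']
  rw [hinv]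
  have htr : (D * of fun _ _ => t⁻¹).trace = D () () * t⁻¹ := by
    simp [Matrix.trace, Matrix.mul_apply]
  rw [htr, det_unique]
  simp only [of_apply, Fintype.card_unit, Nat.cast_one]
  congr 3
  ring

theorem HasInvWishartMoments.unit : HasInvWishartMoments Unit := by
  intro d D hD
  have hb : 0 < D () () / 2 := by
    have := hD.diag_pos (i := ())
    positivity
  have hZ : ∀ {d : ℝ}, 0 < d → ∫⁻ M, invWishartKernel d D M ∂symLebesgue Unit =
      ENNReal.ofReal ((1 / (D () () / 2)) ^ (d / 2) * Real.Gamma (d / 2)) := by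
    intro d hd
    rw [lintegral_symLebesgue_unit (measurable_invWishartKernel _ _),
      ← lintegral_inverse_gamma (half_pos hd) hb, ← lintegral_indicator measurableSet_Ioi]
    refine lintegral_congr fun t => ?_
    by_cases ht : 0 < t
    · rw [Set.indicator_of_mem (Set.mem_Ioi.2 ht), invWishartKernel_unit d D ht]
    · rw [Set.indicator_of_notMem (by simpa using ht),
        invWishartKernel_of_not_posDef _ _ (mt (posDef_unit_iff t).1 ht)]
  refine ⟨fun hd => ?_, fun hd w => ?_⟩
  · rw [hZ hd]
    have := Real.Gamma_pos_of_pos (half_pos hd)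
    exact ⟨by rw [Ne, ENNReal.ofReal_eq_zero, not_le]; positivity, ENNReal.ofReal_ne_top⟩
  · have hm : Measurable fun M : Matrix Unit Unit ℝ =>
        invWishartKernel d D M * ENNReal.ofReal (w ⬝ᵥ M *ᵥ w) :=
      (measurable_invWishartKernel _ _).mul (measurable_quadForm _)
    have hd2 : 0 < d - 2 := by linarith
    -- A factor `t` lowers `d` by `2`, so the mean is a ratio of two masses, which the functional
    -- equation of `Γ` evaluates.
    have hstep : ∫⁻ M, invWishartKernel d D M * ENNReal.ofReal (w ⬝ᵥ M *ᵥ w) ∂symLebesgue Unit =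
        ENNReal.ofReal (w () ^ 2) * ∫⁻ M, invWishartKernel (d - 2) D M ∂symLebesgue Unit := by
      rw [← lintegral_const_mul _ (measurable_invWishartKernel _ _), lintegral_symLebesgue_unit hm,
        lintegral_symLebesgue_unit ((measurable_invWishartKernel _ _).const_mul _)]
      refine lintegral_congr fun t => ?_
      by_cases ht : 0 < t
      · rw [invWishartKernel_unit _ D ht, invWishartKernel_unit _ D ht,
          ← ENNReal.ofReal_mul (by positivity), ← ENNReal.ofReal_mul (by positivity)]
        congr 1
        have hpow : t ^ (-((d - 2) / 2 + 1)) = t ^ (-(d / 2 + 1)) * t := by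
          rw [← Real.rpow_add_one ht.ne']; congr 1; ring
        rw [hpow]
        simp only [dotProduct, mulVec, Finset.univ_unique, Finset.sum_singleton, of_apply]
        simp only [PUnit.default_eq_unit]
        ring
      · simp [invWishartKernel_of_not_posDef _ _ (mt (posDef_unit_iff t).1 ht)]
    rw [hstep, hZ hd2, hZ (by linarith), ← ENNReal.ofReal_mul (sq_nonneg _),
      ← ENNReal.ofReal_mul (by
        simp only [dotProduct, mulVec, Finset.univ_unique, Finset.sum_singleton]
        simp only [PUnit.default_eq_unit]
        have := hD.diag_pos (i := ())
        have : 0 ≤ w () * (D () () * w ()) := by nlinarith [mul_self_nonneg (w ())]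
        positivity)]
    congr 1
    have h1 : d / 2 = (d - 2) / 2 + 1 := by ring
    have h3 : (1 / (D () () / 2)) ^ (d / 2) = (1 / (D () () / 2)) ^ ((d - 2) / 2) *
        (1 / (D () () / 2)) := by
      rw [h1, Real.rpow_add_one (by positivity)]
    have hG : Real.Gamma (d / 2) = (d - 2) / 2 * Real.Gamma ((d - 2) / 2) := by
      rw [h1, Real.Gamma_add_one (by positivity)]
    rw [h3, hG]
    simp only [dotProduct, mulVec, Finset.univ_unique, Finset.sum_singleton]
    simp only [PUnit.default_eq_unit]
    have hD0 : D () () ≠ 0 := by intro h; rw [h] at hb; simp at hb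
    field_simp

theorem hasInvWishartMoments (ι : Type*) [Fintype ι] [DecidableEq ι] : HasInvWishartMoments ι := by
  suffices h : ∀ n : ℕ, HasInvWishartMoments (Fin n) from (h _).of_equiv (Fintype.equivFin ι).symm
  intro n
  induction n with
  | zero => exact .of_isEmpty
  | succ n ih =>
    refine (HasInvWishartMoments.unit.sum ih).of_equiv ?_
    exact (Equiv.sumComm _ _).trans ((Equiv.sumCongr (Equiv.refl _) (Equiv.equivPUnit
      (Fin 1)).symm).trans finSumFinEquiv)

end OneDimensional

/-! ### The transition law and its mean. -/

section Transition

open Matrix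

theorem augScale_eq (n : ℝ) {S : Matrix ι ι ℝ} (F : Matrix ι ι ℝ) (hS : Sᵀ = S) :
    augScale n S F = fromBlocks (n • S) (n • (F * S))ᵀ (n • (F * S)) (n • S) := by
  rw [augScale, fromBlocks_smul, transpose_smul, transpose_mul, hS]

/-- Here `A = n S` and `C = n F S`, so this is the mean `C A⁻¹` of `Γ` for the augmented law. -/
theorem coef_augScale {n : ℝ} (hn : 0 < n) {S : Matrix ι ι ℝ} (F : Matrix ι ι ℝ)
    (hS : S.PosDef) : n • (F * S) * (n • S)⁻¹ = F := by
  have hdet := hS.det_pos.ne'.isUnit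
  have h : (n • S)⁻¹ = n⁻¹ • S⁻¹ := by
    refine inv_eq_right_inv ?_
    rw [smul_mul_smul_comm, mul_nonsing_inv _ hdet, mul_inv_cancel₀ hn.ne', one_smul]
  rw [h, smul_mul_smul_comm, mul_inv_cancel₀ hn.ne', one_smul, Matrix.mul_assoc,
    mul_nonsing_inv _ hdet, Matrix.mul_one]

theorem schur_augScale {n : ℝ} (hn : 0 < n) {S : Matrix ι ι ℝ} (F : Matrix ι ι ℝ)
    (hS : S.PosDef) : n • S - n • (F * S) * (n • S)⁻¹ * (n • (F * S))ᵀ =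
      n • (S - F * S * Fᵀ) := by
  have hST : Sᵀ = S := by simpa using hS.isHermitian.eq
  rw [coef_augScale hn F hS, transpose_smul, transpose_mul, hST, Matrix.mul_smul, smul_sub,
    Matrix.mul_assoc]

theorem posDef_augScale {n : ℝ} (hn : 0 < n) {S F : Matrix ι ι ℝ} (h : Admissible S F) :
    (augScale n S F).PosDef := by
  rw [augScale_eq n F (by simpa using h.1.isHermitian.eq), posDef_fromBlocks_iff (h.1.smul hn),
    schur_augScale hn F h.1]
  exact h.2.smul hn

/-- The joint density of two consecutive states before normalization. -/
def pairKernel (n : ℝ) (S F x y : Matrix ι ι ℝ) : ℝ≥0∞ :=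
  ∫⁻ φ : ι → ι → ℝ, invWishartKernel (n + 2) (augScale n S F) (fromBlocks x (of φ)ᵀ (of φ) y)

theorem measurable_invWishartKernel_fromBlocks (d : ℝ) (D : Matrix (ι ⊕ ι) (ι ⊕ ι) ℝ) :
    Measurable fun p : (Matrix ι ι ℝ × Matrix ι ι ℝ) × (ι → ι → ℝ) =>
      invWishartKernel d D (fromBlocks p.1.1 (of p.2)ᵀ (of p.2) p.1.2) := by
  have h1 : Measurable fun p : (Matrix ι ι ℝ × Matrix ι ι ℝ) × (ι → ι → ℝ) =>
      fromBlocks p.1.1 (of p.2)ᵀ (of p.2) p.1.2 := by fun_prop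
  exact (measurable_invWishartKernel d D).comp h1

theorem measurable_pairKernel (n : ℝ) (S F : Matrix ι ι ℝ) :
    Measurable fun p : Matrix ι ι ℝ × Matrix ι ι ℝ => pairKernel n S F p.1 p.2 :=
  (measurable_invWishartKernel_fromBlocks _ _).lintegral_prod_right'

theorem pairKernel_of_not_posDef_left (n : ℝ) (S F : Matrix ι ι ℝ) {x y : Matrix ι ι ℝ}
    (hx : ¬x.PosDef) : pairKernel n S F x y = 0 := by
  unfold pairKernel
  simp_rw [invWishartKernel_of_not_posDef _ _ fun h => hx (posDef_of_fromBlocks h).1]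
  simp

theorem pairKernel_of_not_posDef_right (n : ℝ) (S F : Matrix ι ι ℝ) {x y : Matrix ι ι ℝ}
    (hy : ¬y.PosDef) : pairKernel n S F x y = 0 := by
  unfold pairKernel
  simp_rw [invWishartKernel_of_not_posDef _ _ fun h => hy (posDef_of_fromBlocks h).2]
  simp

theorem pairDensity_eq {n : ℝ} (hn : 0 < n) {S F : Matrix ι ι ℝ} (h : Admissible S F)
    (x y : Matrix ι ι ℝ) : pairDensity n S F x y = pairKernel n S F x y /
      ∫⁻ N, invWishartKernel (n + 2) (augScale n S F) N ∂symLebesgue (ι ⊕ ι) := by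
  have hZ := ((hasInvWishartMoments (ι ⊕ ι)) (n + 2) _ (posDef_augScale hn h)).1 (by linarith)
  simp only [pairDensity, pairKernel, invWishartPDF, div_eq_mul_inv]
  rw [lintegral_mul_const' _ _ (ENNReal.inv_ne_top.2 hZ.1)]

/-- The marginal of `pairKernel`. -/
theorem lintegral_pairKernel {n : ℝ} (hn : 0 < n) {S F : Matrix ι ι ℝ} (h : Admissible S F)
    {x : Matrix ι ι ℝ} (hx : x.PosDef) : ∫⁻ y, pairKernel n S F x y ∂symLebesgue ι =
      matrixNormalMass ι (n • S) * invWishartKernel (n + 2) (n • S) x *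
        ∫⁻ Ψ, invWishartKernel (n + 2 + Fintype.card ι) (n • (S - F * S * Fᵀ)) Ψ
          ∂symLebesgue ι := by
  unfold pairKernel
  rw [augScale_eq n F (by simpa using h.1.isHermitian.eq),
    lintegral_invWishartKernel_block_one _ hx (h.1.smul hn), schur_augScale hn F h.1]

theorem lintegral_pairKernel_ne {n : ℝ} (hn : 0 < n) {S F : Matrix ι ι ℝ} (h : Admissible S F)
    {x : Matrix ι ι ℝ} (hx : x.PosDef) : ∫⁻ y, pairKernel n S F x y ∂symLebesgue ι ≠ 0 ∧
      ∫⁻ y, pairKernel n S F x y ∂symLebesgue ι ≠ ∞ := by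
  have hZ := ((hasInvWishartMoments ι) (n + 2 + Fintype.card ι) _ (h.2.smul hn)).1 (by positivity)
  rw [lintegral_pairKernel hn h hx]
  refine ⟨mul_ne_zero (mul_ne_zero (matrixNormalMass_ne_zero (h.1.smul hn)) ?_) hZ.1,
    ENNReal.mul_ne_top (ENNReal.mul_ne_top matrixNormalMass_ne_top
      (invWishartKernel_ne_top _ _ _)) hZ.2⟩
  rw [invWishartKernel, if_pos hx, Ne, ENNReal.ofReal_eq_zero, not_le]
  have := hx.det_pos
  positivity

/-- The normalizing constant of the augmented law is positive and finite, hence cancels in the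
conditional density. -/
theorem transition_eq {n : ℝ} (hn : 0 < n) {S F : Matrix ι ι ℝ} (h : Admissible S F)
    (x : Matrix ι ι ℝ) : transition n S F x = (symLebesgue ι).withDensity fun y =>
      pairKernel n S F x y / ∫⁻ y', pairKernel n S F x y' ∂symLebesgue ι := by
  have hZ := ((hasInvWishartMoments (ι ⊕ ι)) (n + 2) _ (posDef_augScale hn h)).1 (by linarith)
  unfold transition
  congr 1
  funext y
  simp_rw [pairDensity_eq hn h, div_eq_mul_inv]
  rw [lintegral_mul_const' _ _ (ENNReal.inv_ne_top.2 hZ.1), ← div_eq_mul_inv, ← div_eq_mul_inv,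
    ← div_eq_mul_inv]
  exact ENNReal.mul_div_mul_right _ _ (ENNReal.inv_ne_zero.2 hZ.2) (ENNReal.inv_ne_top.2 hZ.1)

theorem measurable_transition {n : ℝ} (hn : 0 < n) {S F : Matrix ι ι ℝ} (h : Admissible S F) :
    Measurable (transition n S F) := by
  have h1 := measurable_pairKernel n S F
  have h2 : Measurable fun x => ∫⁻ y', pairKernel n S F x y' ∂symLebesgue ι :=
    h1.lintegral_prod_right'
  have h3 : Measurable fun p : Matrix ι ι ℝ × Matrix ι ι ℝ => pairKernel n S F p.1 p.2 /
      ∫⁻ y', pairKernel n S F p.1 y' ∂symLebesgue ι := h1.div (h2.comp measurable_fst)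
  rw [funext (transition_eq hn h)]
  exact measurable_withDensity h3

theorem lintegral_transition {n : ℝ} (hn : 0 < n) {S F : Matrix ι ι ℝ} (h : Admissible S F)
    (x : Matrix ι ι ℝ) {g : Matrix ι ι ℝ → ℝ≥0∞} (hg : Measurable g) :
    ∫⁻ y, g y ∂transition n S F x = (∫⁻ y, pairKernel n S F x y * g y ∂symLebesgue ι) /
      ∫⁻ y, pairKernel n S F x y ∂symLebesgue ι := by
  have h1 : Measurable fun y => pairKernel n S F x y :=
    (measurable_pairKernel n S F).comp measurable_prodMk_left
  have h2 : Measurable fun y => pairKernel n S F x y * g y := h1.mul hg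
  rw [transition_eq hn h, lintegral_withDensity_eq_lintegral_mul _ (h1.div_const _) hg,
    div_eq_mul_inv, ← lintegral_mul_const _ h2]
  refine lintegral_congr fun y => ?_
  rw [Pi.mul_apply, div_eq_mul_inv]
  ring

theorem isProbabilityMeasure_transition {n : ℝ} (hn : 0 < n) {S F : Matrix ι ι ℝ}
    (h : Admissible S F) {x : Matrix ι ι ℝ} (hx : x.PosDef) :
    IsProbabilityMeasure (transition n S F x) := by
  have h1 := lintegral_transition hn h x (g := fun _ => 1) measurable_const
  simp only [mul_one, lintegral_one] at h1
  obtain ⟨h2, h3⟩ := lintegral_pairKernel_ne hn h hx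
  exact ⟨by rw [h1, ENNReal.div_self h2 h3]⟩

theorem ae_posDef_transition {n : ℝ} (hn : 0 < n) {S F : Matrix ι ι ℝ} (h : Admissible S F)
    (x : Matrix ι ι ℝ) : ∀ᵐ y ∂transition n S F x, y.PosDef := by
  have h1 : Measurable fun y => pairKernel n S F x y :=
    (measurable_pairKernel n S F).comp measurable_prodMk_left
  rw [transition_eq hn h, ae_withDensity_iff (h1.div_const _)]
  refine ae_of_all _ fun y hy => ?_
  by_contra hc
  exact hy (by rw [pairKernel_of_not_posDef_right _ _ _ hc, ENNReal.zero_div])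

/-- The mean of `Σ_{t+1}` as a function of `Σ_t`. -/
def meanStep (n : ℝ) (S F x : Matrix ι ι ℝ) : Matrix ι ι ℝ :=
  F * x * Fᵀ + ((n + (x * S⁻¹).trace) / (n + Fintype.card ι)) • (S - F * S * Fᵀ)

theorem meanStep_posSemidef {n : ℝ} (hn : 0 < n) {S F : Matrix ι ι ℝ} (h : Admissible S F)
    {x : Matrix ι ι ℝ} (hx : x.PosSemidef) : (meanStep n S F x).PosSemidef := by
  have h1 := hx.mul_mul_conjTranspose_same F
  rw [conjTranspose_eq_transpose_of_trivial] at h1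
  refine h1.add (h.2.posSemidef.smul ?_)
  have := trace_mul_nonneg_of_posSemidef hx h.1.inv.posSemidef
  positivity

/-- The central computation. Given `x`, `Ψ` has mean `n V / (n + q)` and is counted `1 + n⁻¹ tr(x
S⁻¹)` times, while the mean `F` of `Γ` contributes `F x F'`. -/
theorem lintegral_transition_quadForm {n : ℝ} (hn : 0 < n) {S F : Matrix ι ι ℝ}
    (h : Admissible S F) {x : Matrix ι ι ℝ} (hx : x.PosDef) (w : ι → ℝ) :
    ∫⁻ y, ENNReal.ofReal (w ⬝ᵥ y *ᵥ w) ∂transition n S F x =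
      ENNReal.ofReal (w ⬝ᵥ meanStep n S F x *ᵥ w) := by
  have hV := h.2.smul hn
  have hq : (0 : ℝ) ≤ Fintype.card ι := Nat.cast_nonneg _
  have hZ := (hasInvWishartMoments ι) (n + 2 + Fintype.card ι) _ hV
  obtain ⟨hN0, hNtop⟩ := lintegral_pairKernel_ne hn h hx
  rw [lintegral_transition hn h x (measurable_quadForm w)]
  have hnum : ∫⁻ y, pairKernel n S F x y * ENNReal.ofReal (w ⬝ᵥ y *ᵥ w) ∂symLebesgue ι =
      ENNReal.ofReal (w ⬝ᵥ meanStep n S F x *ᵥ w) *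
        ∫⁻ y, pairKernel n S F x y ∂symLebesgue ι := by
    -- The vector `(0, w)` selects the block `y`. `Ψ` has `n + 2 + q` degrees of freedom, so its
    -- mean has denominator `n + q`.
    have hb := lintegral_invWishartKernel_block_quadForm (n + 2) hx (h.1.smul hn) (n • (F * S))
      (n • S) 0 w
    have hquad : ∀ (y : Matrix ι ι ℝ) (φ : ι → ι → ℝ),
        Sum.elim (0 : ι → ℝ) w ⬝ᵥ fromBlocks x (of φ)ᵀ (of φ) y *ᵥ Sum.elim (0 : ι → ℝ) w =
          w ⬝ᵥ y *ᵥ w := by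
      intro y φ
      rw [fromBlocks_mulVec, sumElim_dotProduct_sumElim]
      simp
    simp_rw [hquad] at hb
    rw [schur_augScale hn F h.1, coef_augScale hn F h.1, hZ.2 (by linarith), zero_add,
      ← augScale_eq n F (by simpa using h.1.isHermitian.eq)] at hb
    simp_rw [lintegral_mul_const' _ _ ENNReal.ofReal_ne_top] at hb
    rw [lintegral_pairKernel hn h hx]
    refine hb.trans ?_
    have htr : 0 ≤ (x * S⁻¹).trace :=
      trace_mul_nonneg_of_posSemidef hx.posSemidef h.1.inv.posSemidef
    have hVw := quadForm_nonneg h.2.posSemidef w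
    have hinv : (n • S)⁻¹ = n⁻¹ • S⁻¹ := by
      refine inv_eq_right_inv ?_
      rw [smul_mul_smul_comm, mul_nonsing_inv _ h.1.det_pos.ne'.isUnit, mul_inv_cancel₀ hn.ne',
        one_smul]
    have htr' : (x * (n • S)⁻¹).trace = n⁻¹ * (x * S⁻¹).trace := by
      rw [hinv, Matrix.mul_smul, trace_smul, smul_eq_mul]
    have hmean : w ⬝ᵥ meanStep n S F x *ᵥ w = (1 + n⁻¹ * (x * S⁻¹).trace) *
        (w ⬝ᵥ (n • (S - F * S * Fᵀ)) *ᵥ w / (n + 2 + Fintype.card ι - 2)) +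
          (Fᵀ *ᵥ w) ⬝ᵥ x *ᵥ (Fᵀ *ᵥ w) := by
      have h1 : (Fᵀ *ᵥ w) ⬝ᵥ x *ᵥ (Fᵀ *ᵥ w) = w ⬝ᵥ (F * x * Fᵀ) *ᵥ w := by
        rw [← mulVec_mulVec, ← mulVec_mulVec, dotProduct_mulVec w F, ← mulVec_transpose F]
      have h2 : n + 2 + (Fintype.card ι : ℝ) - 2 = n + Fintype.card ι := by ring
      rw [h1, h2, meanStep, add_mulVec, dotProduct_add, smul_mulVec, dotProduct_smul, smul_mulVec,
        dotProduct_smul, smul_eq_mul, smul_eq_mul]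
      have h3 : n + (Fintype.card ι : ℝ) ≠ 0 := by positivity
      field_simp
      ring
    rw [htr', hmean, ENNReal.ofReal_add (mul_nonneg (by positivity) (by
      rw [smul_mulVec, dotProduct_smul, smul_eq_mul]
      exact div_nonneg (mul_nonneg hn.le hVw) (by linarith)))
      (quadForm_nonneg hx.posSemidef _), ENNReal.ofReal_mul (by positivity)]
    ring
  rw [hnum, ENNReal.mul_div_cancel_right hN0 hNtop]

/-- `w ↦ w' M w` as a linear function of `M`. -/
def quadFormLin (w : ι → ℝ) : Matrix ι ι ℝ →ₗ[ℝ] ℝ where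
  toFun M := w ⬝ᵥ M *ᵥ w
  map_add' M N := by rw [add_mulVec, dotProduct_add]
  map_smul' c M := by rw [smul_mulVec, dotProduct_smul]; rfl

theorem integral_linear_of_entries {Ω : Type*} [MeasurableSpace Ω] {μ : Measure Ω}
    {Y : Ω → Matrix ι ι ℝ} {N : Matrix ι ι ℝ}
    (h : ∀ i j, Integrable (fun ω => Y ω i j) μ ∧ ∫ ω, Y ω i j ∂μ = N i j)
    (ℓ : Matrix ι ι ℝ →ₗ[ℝ] ℝ) :
    Integrable (fun ω => ℓ (Y ω)) μ ∧ ∫ ω, ℓ (Y ω) ∂μ = ℓ N := by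
  have hexp : ∀ M : Matrix ι ι ℝ, ℓ M = ∑ i, ∑ j, M i j * ℓ (single i j 1) := by
    intro M
    conv_lhs => rw [matrix_eq_sum_single M]
    simp_rw [map_sum]
    refine Finset.sum_congr rfl fun i _ => Finset.sum_congr rfl fun j _ => ?_
    rw [← smul_eq_mul, ← map_smul, smul_single, smul_eq_mul, mul_one]
  have hY : (fun ω => ℓ (Y ω)) = fun ω => ∑ i, ∑ j, Y ω i j * ℓ (single i j 1) :=
    funext fun ω => hexp _
  rw [hY, hexp N]
  have hi : ∀ i j, Integrable (fun ω => Y ω i j * ℓ (single i j 1)) μ := fun i j =>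
    (h i j).1.mul_const _
  refine ⟨integrable_finsetSum _ fun i _ => integrable_finsetSum _ fun j _ => hi i j, ?_⟩
  rw [integral_finsetSum _ fun i _ => integrable_finsetSum _ fun j _ => hi i j]
  refine Finset.sum_congr rfl fun i _ => ?_
  rw [integral_finsetSum _ fun j _ => hi i j]
  exact Finset.sum_congr rfl fun j _ => by rw [integral_mul_const, (h i j).2]

/-- The forms are nonnegative almost everywhere, so their finite `ℝ≥0∞` integrals give
integrability, and polarization gives the entries. -/
theorem integral_entries_of_quadForm {μ : Measure (Matrix ι ι ℝ)} (hμ : ∀ᵐ y ∂μ, y.PosDef)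
    {N : Matrix ι ι ℝ} (hN : N.PosSemidef)
    (h : ∀ w : ι → ℝ, ∫⁻ y, ENNReal.ofReal (w ⬝ᵥ y *ᵥ w) ∂μ = ENNReal.ofReal (w ⬝ᵥ N *ᵥ w))
    (i j : ι) : Integrable (fun y : Matrix ι ι ℝ => y i j) μ ∧ ∫ y, y i j ∂μ = N i j := by
  have hm : ∀ w : ι → ℝ, AEStronglyMeasurable (fun y : Matrix ι ι ℝ => w ⬝ᵥ y *ᵥ w) μ := fun w =>
    (by fun_prop : Continuous fun y : Matrix ι ι ℝ => w ⬝ᵥ y *ᵥ w).measurable.aestronglyMeasurable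
  have hnn : ∀ w : ι → ℝ, 0 ≤ᵐ[μ] fun y : Matrix ι ι ℝ => w ⬝ᵥ y *ᵥ w := fun w => by
    filter_upwards [hμ] with y hy using quadForm_nonneg hy.posSemidef w
  have hint : ∀ w : ι → ℝ, Integrable (fun y : Matrix ι ι ℝ => w ⬝ᵥ y *ᵥ w) μ := fun w =>
    ⟨hm w, (hasFiniteIntegral_iff_ofReal (hnn w)).2 (by rw [h w]; exact ENNReal.ofReal_lt_top)⟩
  have hval : ∀ w : ι → ℝ, ∫ y, w ⬝ᵥ y *ᵥ w ∂μ = w ⬝ᵥ N *ᵥ w := fun w => by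
    rw [integral_eq_lintegral_of_nonneg_ae (hnn w) (hm w), h w,
      ENNReal.toReal_ofReal (quadForm_nonneg hN w)]
  have hpol : ∀ M : Matrix ι ι ℝ, Mᵀ = M → M i j =
      ((Pi.single i 1 + Pi.single j 1) ⬝ᵥ M *ᵥ (Pi.single i 1 + Pi.single j 1) -
        Pi.single i 1 ⬝ᵥ M *ᵥ Pi.single i 1 - Pi.single j 1 ⬝ᵥ M *ᵥ Pi.single j 1) / 2 := by
    intro M hM
    have hs : M j i = M i j := congrFun (congrFun hM i) j
    simp only [mulVec_add, add_dotProduct, dotProduct_add, single_one_dotProduct, mulVec_single_one,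
      col_apply]
    rw [hs]
    ring
  have hae : (fun y : Matrix ι ι ℝ => y i j) =ᵐ[μ] fun y =>
      ((Pi.single i 1 + Pi.single j 1) ⬝ᵥ y *ᵥ (Pi.single i 1 + Pi.single j 1) -
        Pi.single i 1 ⬝ᵥ y *ᵥ Pi.single i 1 - Pi.single j 1 ⬝ᵥ y *ᵥ Pi.single j 1) / 2 := by
    filter_upwards [hμ] with y hy using hpol y (by simpa using hy.isHermitian.eq)
  have h12 : Integrable (fun y : Matrix ι ι ℝ =>
      (Pi.single i 1 + Pi.single j 1) ⬝ᵥ y *ᵥ (Pi.single i 1 + Pi.single j 1) -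
        Pi.single i 1 ⬝ᵥ y *ᵥ Pi.single i 1) μ :=
    (hint (Pi.single i 1 + Pi.single j 1)).sub (hint (Pi.single i 1))
  refine ⟨((h12.sub (hint (Pi.single j 1))).div_const 2).congr hae.symm, ?_⟩
  rw [integral_congr_ae hae, integral_div, integral_sub h12 (hint _), integral_sub (hint _) (hint _),
    hval, hval, hval, ← hpol N (by simpa using hN.isHermitian.eq)]

/-- The linear part of `meanStep`. -/
def meanStepLin (n : ℝ) (S F : Matrix ι ι ℝ) : Matrix ι ι ℝ →ₗ[ℝ] Matrix ι ι ℝ where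
  toFun x := F * x * Fᵀ + ((x * S⁻¹).trace / (n + Fintype.card ι)) • (S - F * S * Fᵀ)
  map_add' x y := by
    rw [Matrix.mul_add, Matrix.add_mul, Matrix.add_mul, trace_add, add_div, add_smul]
    abel
  map_smul' c x := by
    rw [Matrix.mul_smul, Matrix.smul_mul, Matrix.smul_mul, trace_smul, smul_eq_mul, mul_div_assoc,
      mul_smul, smul_add]
    rfl

theorem meanStep_eq_lin (n : ℝ) (S F x : Matrix ι ι ℝ) : meanStep n S F x =
    meanStepLin n S F x + (n / (n + Fintype.card ι)) • (S - F * S * Fᵀ) := by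
  rw [meanStep, add_div, add_smul, add_comm ((n / _) • _), ← add_assoc]
  rfl

theorem integral_meanStep_entries {Ω : Type*} [MeasurableSpace Ω] {μ : Measure Ω}
    [IsProbabilityMeasure μ] (n : ℝ) (S F : Matrix ι ι ℝ) {Y : Ω → Matrix ι ι ℝ} {N : Matrix ι ι ℝ}
    (h : ∀ i j, Integrable (fun ω => Y ω i j) μ ∧ ∫ ω, Y ω i j ∂μ = N i j) (i j : ι) :
    Integrable (fun ω => meanStep n S F (Y ω) i j) μ ∧
      ∫ ω, meanStep n S F (Y ω) i j ∂μ = meanStep n S F N i j := by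
  have hl : Integrable (fun ω => meanStepLin n S F (Y ω) i j) μ ∧
      ∫ ω, meanStepLin n S F (Y ω) i j ∂μ = meanStepLin n S F N i j :=
    integral_linear_of_entries h (entryLinearMap ℝ ℝ i j ∘ₗ meanStepLin n S F)
  simp_rw [meanStep_eq_lin, Matrix.add_apply]
  refine ⟨hl.1.add (integrable_const _), ?_⟩
  rw [integral_add hl.1 (integrable_const _), hl.2]
  simp

/-- The four claims must be proved together: the one-step mean is available only at positive
definite states, and passing the affine `meanStep` through the integral needs total mass one and
integrable entries. -/
theorem lawAt_spec {n : ℝ} (hn : 0 < n) {S F : Matrix ι ι ℝ} (h : Admissible S F)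
    {x : Matrix ι ι ℝ} (hx : x.PosDef) (t : ℕ) :
    IsProbabilityMeasure (lawAt n S F t x) ∧ (∀ᵐ y ∂lawAt n S F t x, y.PosDef) ∧
      ((meanStep n S F)^[t] x).PosSemidef ∧
      ∀ w : ι → ℝ, ∫⁻ y, ENNReal.ofReal (w ⬝ᵥ y *ᵥ w) ∂lawAt n S F t x =
        ENNReal.ofReal (w ⬝ᵥ (meanStep n S F)^[t] x *ᵥ w) := by
  induction t with
  | zero =>
    refine ⟨by unfold lawAt; infer_instance, ?_, hx.posSemidef, fun w => ?_⟩
    · rw [lawAt, ae_dirac_iff measurableSet_posDef]; exact hx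
    · rw [lawAt, lintegral_dirac' _ (measurable_quadForm w)]; rfl
  | succ t ih =>
    obtain ⟨ih1, ih2, ih3, ih4⟩ := ih
    have hT := measurable_transition hn h
    have hent := integral_entries_of_quadForm ih2 ih3 ih4
    rw [Function.iterate_succ_apply']
    refine ⟨⟨?_⟩, ?_, meanStep_posSemidef hn h ih3, fun w => ?_⟩
    · rw [lawAt, Measure.bind_apply .univ hT.aemeasurable,
        lintegral_congr_ae (g := fun _ => 1), lintegral_one, measure_univ]
      filter_upwards [ih2] with y hy
      have := isProbabilityMeasure_transition hn h hy
      exact measure_univ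
    · rw [ae_iff, ← Set.compl_ofPred, lawAt, Measure.bind_apply measurableSet_posDef.compl
        hT.aemeasurable]
      refine (lintegral_congr fun y => ?_).trans lintegral_zero
      exact ae_iff.1 (ae_posDef_transition hn h y)
    · rw [lawAt, Measure.lintegral_bind hT.aemeasurable (measurable_quadForm w).aemeasurable,
        lintegral_congr_ae (g := fun y => ENNReal.ofReal (w ⬝ᵥ meanStep n S F y *ᵥ w))]
      · have h1 := integral_linear_of_entries (integral_meanStep_entries n S F hent) (quadFormLin w)
        have h2 := ofReal_integral_eq_lintegral_ofReal h1.1 (by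
          filter_upwards [ih2] with y hy
          exact quadForm_nonneg (meanStep_posSemidef hn h hy.posSemidef) w)
        rw [h1.2] at h2
        exact h2.symm
      · filter_upwards [ih2] with y hy using lintegral_transition_quadForm hn h hy w

theorem integrable_entry_lawAt {n : ℝ} (hn : 0 < n) {S F : Matrix ι ι ℝ} (h : Admissible S F)
    {x : Matrix ι ι ℝ} (hx : x.PosDef) (t : ℕ) (i j : ι) :
    Integrable (fun y : Matrix ι ι ℝ => y i j) (lawAt n S F t x) :=
  have h4 := lawAt_spec hn h hx t
  (integral_entries_of_quadForm h4.2.1 h4.2.2.1 h4.2.2.2 i j).1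

theorem condMean_eq_iterate {n : ℝ} (hn : 0 < n) {S F : Matrix ι ι ℝ} (h : Admissible S F)
    {x : Matrix ι ι ℝ} (hx : x.PosDef) (t : ℕ) :
    condMean n S F t x = (meanStep n S F)^[t] x := by
  ext i j
  have h4 := lawAt_spec hn h hx t
  exact (integral_entries_of_quadForm h4.2.1 h4.2.2.1 h4.2.2.2 i j).2

end Transition

/-! ### `condMean` is a version of the conditional expectation. -/

section ProcessLaw

open Matrix

theorem measurable_blocks : Measurable fun M : Matrix (ι ⊕ ι) (ι ⊕ ι) ℝ =>
    (M.toBlocks₁₁, M.toBlocks₂₂) :=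
  (measurable_matrix_iff.2 fun _ _ => measurable_matrix_apply _ _).prodMk
    (measurable_matrix_iff.2 fun _ _ => measurable_matrix_apply _ _)

theorem lintegral_pairLaw {n : ℝ} (S F : Matrix ι ι ℝ) {g : Matrix ι ι ℝ × Matrix ι ι ℝ → ℝ≥0∞}
    (hg : Measurable g) :
    ∫⁻ p, g p ∂(invWishart (n + 2) (augScale n S F)).map
        (fun M => (M.toBlocks₁₁, M.toBlocks₂₂)) =
      (∫⁻ x, (∫⁻ y, pairKernel n S F x y * g (x, y) ∂symLebesgue ι) ∂symLebesgue ι) /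
        ∫⁻ N, invWishartKernel (n + 2) (augScale n S F) N ∂symLebesgue (ι ⊕ ι) := by
  have hk : Measurable fun M => invWishartKernel (n + 2) (augScale n S F) M :=
    measurable_invWishartKernel _ _
  have hgb : Measurable fun M : Matrix (ι ⊕ ι) (ι ⊕ ι) ℝ => g (M.toBlocks₁₁, M.toBlocks₂₂) :=
    hg.comp measurable_blocks
  have hkg : Measurable fun M : Matrix (ι ⊕ ι) (ι ⊕ ι) ℝ =>
      invWishartKernel (n + 2) (augScale n S F) M * g (M.toBlocks₁₁, M.toBlocks₂₂) := hk.mul hgb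
  rw [lintegral_map hg measurable_blocks, invWishart, lintegral_withDensity_eq_lintegral_mul _
    (show Measurable (invWishartPDF (n + 2) (augScale n S F)) from hk.div_const _) hgb]
  have hpt : ∀ M : Matrix (ι ⊕ ι) (ι ⊕ ι) ℝ, (invWishartPDF (n + 2) (augScale n S F) *
      fun M : Matrix (ι ⊕ ι) (ι ⊕ ι) ℝ => g (M.toBlocks₁₁, M.toBlocks₂₂)) M =
      invWishartKernel (n + 2) (augScale n S F) M * g (M.toBlocks₁₁, M.toBlocks₂₂) *
        (∫⁻ N, invWishartKernel (n + 2) (augScale n S F) N ∂symLebesgue (ι ⊕ ι))⁻¹ := by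
    intro M
    rw [Pi.mul_apply, invWishartPDF, div_eq_mul_inv]
    ring
  simp_rw [hpt]
  rw [lintegral_mul_const _ hkg, div_eq_mul_inv, lintegral_symLebesgue_sum _ hkg]
  congr 1
  refine lintegral_congr fun x => lintegral_congr fun y => ?_
  simp only [toBlocks_fromBlocks₁₁, toBlocks_fromBlocks₂₂]
  have h1 : Measurable fun φ : ι → ι → ℝ =>
      invWishartKernel (n + 2) (augScale n S F) (fromBlocks x (of φ)ᵀ (of φ) y) := by
    have h := (measurable_invWishartKernel_fromBlocks (n + 2) (augScale n S F)).comp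
      (measurable_prodMk_left (x := (x, y)))
    exact h
  rw [lintegral_mul_const _ h1]
  rfl

variable {Ω : Type*} [mΩ : MeasurableSpace Ω] {P : Measure Ω} {n : ℝ} {S F : Matrix ι ι ℝ}
  {X : ℕ → Ω → Matrix ι ι ℝ}

theorem IsIWAR.lintegral_pair (hX : IsIWAR P n S F X) (t : ℕ)
    {g : Matrix ι ι ℝ × Matrix ι ι ℝ → ℝ≥0∞} (hg : Measurable g) :
    ∫⁻ ω, g (X t ω, X (t + 1) ω) ∂P =
      (∫⁻ x, (∫⁻ y, pairKernel n S F x y * g (x, y) ∂symLebesgue ι) ∂symLebesgue ι) /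
        ∫⁻ N, invWishartKernel (n + 2) (augScale n S F) N ∂symLebesgue (ι ⊕ ι) := by
  rw [← lintegral_pairLaw S F hg, ← hX.pair_law t,
    lintegral_map hg ((hX.measurable t).prodMk (hX.measurable (t + 1)))]

theorem IsIWAR.ae_posDef (hX : IsIWAR P n S F X) (t : ℕ) : ∀ᵐ ω ∂P, (X t ω).PosDef := by
  have hm : MeasurableSet {M : Matrix ι ι ℝ | M.PosDef}ᶜ := measurableSet_posDef.compl
  have h := hX.lintegral_pair t
    (g := fun p => Set.indicator {M : Matrix ι ι ℝ | M.PosDef}ᶜ (fun _ => 1) p.1)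
    ((measurable_const.indicator hm).comp measurable_fst)
  have h0 : ∀ x y : Matrix ι ι ℝ, pairKernel n S F x y *
      Set.indicator {M : Matrix ι ι ℝ | M.PosDef}ᶜ (fun _ => (1 : ℝ≥0∞)) x = 0 := by
    intro x y
    by_cases hx : x.PosDef
    · rw [Set.indicator_of_notMem (by simpa using hx), mul_zero]
    · rw [pairKernel_of_not_posDef_left _ _ _ hx, zero_mul]
  simp only [h0, lintegral_zero, ENNReal.zero_div] at h
  have h2 : ∫⁻ ω, Set.indicator (X t ⁻¹' {M : Matrix ι ι ℝ | M.PosDef}ᶜ) (fun _ => 1) ω ∂P = 0 := h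
  rw [lintegral_indicator_const (hX.measurable t hm), one_mul] at h2
  exact h2

/-- Disintegration of the joint kernel into marginal and transition. There is no exceptional set of
`x`, since both sides vanish off the positive definite matrices. -/
theorem lintegral_pairKernel_mul (hn : 0 < n) (h : Admissible S F) (x : Matrix ι ι ℝ)
    {g : Matrix ι ι ℝ → ℝ≥0∞} (hg : Measurable g) :
    ∫⁻ y, pairKernel n S F x y * g y ∂symLebesgue ι =
      (∫⁻ y, g y ∂transition n S F x) * ∫⁻ y, pairKernel n S F x y ∂symLebesgue ι := by
  by_cases hx : x.PosDef
  · obtain ⟨h0, htop⟩ := lintegral_pairKernel_ne hn h hx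
    rw [lintegral_transition hn h x hg, ENNReal.div_mul_cancel h0 htop]
  · simp [pairKernel_of_not_posDef_left _ _ _ hx]

theorem IsIWAR.measure_inter (hX : IsIWAR P n S F X) (hn : 0 < n) (h : Admissible S F) (t : ℕ)
    {A B : Set (Matrix ι ι ℝ)} (hA : MeasurableSet A) (hB : MeasurableSet B) :
    P (X t ⁻¹' A ∩ X (t + 1) ⁻¹' B) = ∫⁻ ω in X t ⁻¹' A, transition n S F (X t ω) B ∂P := by
  have hT : Measurable fun x => transition n S F x B :=
    (Measure.measurable_coe hB).comp (measurable_transition hn h)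
  have hiB : Measurable (B.indicator fun _ => (1 : ℝ≥0∞)) := measurable_const.indicator hB
  have hiA : Measurable (A.indicator fun _ => (1 : ℝ≥0∞)) := measurable_const.indicator hA
  have h1 := hX.lintegral_pair t
    (g := fun p => A.indicator (fun _ => 1) p.1 * B.indicator (fun _ => 1) p.2)
    ((hiA.comp measurable_fst).mul (hiB.comp measurable_snd))
  have h2 := hX.lintegral_pair t
    (g := fun p => A.indicator (fun _ => 1) p.1 * transition n S F p.1 B)
    ((hiA.comp measurable_fst).mul (hT.comp measurable_fst))
  have hL : ∫⁻ ω, A.indicator (fun _ => 1) (X t ω) * B.indicator (fun _ => 1) (X (t + 1) ω) ∂P =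
      P (X t ⁻¹' A ∩ X (t + 1) ⁻¹' B) := by
    rw [← lintegral_indicator_one ((hX.measurable t hA).inter (hX.measurable (t + 1) hB))]
    refine lintegral_congr fun ω => ?_
    by_cases hωA : X t ω ∈ A <;> by_cases hωB : X (t + 1) ω ∈ B <;>
      simp [Set.indicator, hωA, hωB]
  have hR : ∫⁻ ω, A.indicator (fun _ => 1) (X t ω) * transition n S F (X t ω) B ∂P =
      ∫⁻ ω in X t ⁻¹' A, transition n S F (X t ω) B ∂P := by
    rw [← lintegral_indicator (hX.measurable t hA)]
    refine lintegral_congr fun ω => ?_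
    by_cases hωA : X t ω ∈ A <;> simp [Set.indicator, hωA]
  rw [← hL, ← hR]
  refine h1.trans (Eq.trans ?_ h2.symm)
  congr 1
  refine lintegral_congr fun x => ?_
  have hk : Measurable fun y => pairKernel n S F x y :=
    (measurable_pairKernel n S F).comp measurable_prodMk_left
  dsimp only
  rw [lintegral_pairKernel_mul hn h x (hiB.const_mul _), lintegral_const_mul _ hiB,
    lintegral_indicator_const hB, one_mul, lintegral_mul_const _ hk, mul_comm]

theorem IsIWAR.condExp_eq_transition [IsProbabilityMeasure P] (hX : IsIWAR P n S F X) (hn : 0 < n)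
    (h : Admissible S F) (t : ℕ) {B : Set (Matrix ι ι ℝ)} (hB : MeasurableSet B) :
    Integrable (fun ω => (transition n S F (X t ω) B).toReal) P ∧
    (fun ω => (transition n S F (X t ω) B).toReal)
      =ᵐ[P] P⟦X (t + 1) ⁻¹' B | MeasurableSpace.comap (X t) inferInstance⟧ := by
  have hT : Measurable fun x => transition n S F x B :=
    (Measure.measurable_coe hB).comp (measurable_transition hn h)
  have hTX : Measurable fun ω => transition n S F (X t ω) B := hT.comp (hX.measurable t)
  have hle : ∀ᵐ ω ∂P, transition n S F (X t ω) B ≤ 1 := by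
    filter_upwards [hX.ae_posDef t] with ω hω
    have := isProbabilityMeasure_transition hn h hω
    exact prob_le_one
  have hint : Integrable (fun ω => (transition n S F (X t ω) B).toReal) P := by
    refine integrable_toReal_of_lintegral_ne_top hTX.aemeasurable (ne_top_of_le_ne_top
      (b := ∫⁻ _, 1 ∂P) (by simp) (lintegral_mono_ae hle))
  have hms : MeasurableSet (X (t + 1) ⁻¹' B) := hX.measurable (t + 1) hB
  refine ⟨hint, ae_eq_condExp_of_forall_setIntegral_eq (hX.measurable t).comap_le
    ((integrable_const _).indicator hms) (fun _ _ _ => hint.integrableOn) ?_ ?_⟩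
  · rintro _ ⟨A, hA, rfl⟩ _
    rw [integral_toReal hTX.aemeasurable (ae_restrict_of_ae (hle.mono fun ω hω =>
      hω.trans_lt ENNReal.one_lt_top)), ← hX.measure_inter hn h t hA hB, setIntegral_indicator hms,
      setIntegral_const]
    simp [Measure.real]
  · exact (hT.ennreal_toReal.comp (comap_measurable (X t))).aestronglyMeasurable

/-- The Markov property as an identity of measures on each event of the past, a form that applies to
the unbounded quadratic forms and not only to indicators. -/
theorem IsIWAR.map_restrict [IsProbabilityMeasure P] (hX : IsIWAR P n S F X) (hn : 0 < n)
    (h : Admissible S F) (t : ℕ) {A : Set Ω}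
    (hA : MeasurableSet[⨆ s ≤ t, MeasurableSpace.comap (X s) inferInstance] A) :
    (P.restrict A).map (X (t + 1)) = ((P.restrict A).map (X t)).bind (transition n S F) := by
  have hm : (⨆ s ≤ t, MeasurableSpace.comap (X s) inferInstance) ≤ mΩ :=
    iSup₂_le fun s _ => (hX.measurable s).comap_le
  ext B hB
  have hT : Measurable fun x => transition n S F x B :=
    (Measure.measurable_coe hB).comp (measurable_transition hn h)
  have hTX : Measurable fun ω => transition n S F (X t ω) B := hT.comp (hX.measurable t)
  have hms : MeasurableSet (X (t + 1) ⁻¹' B) := hX.measurable (t + 1) hB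
  obtain ⟨hint, hce⟩ := hX.condExp_eq_transition hn h t hB
  have hle : ∀ᵐ ω ∂P, transition n S F (X t ω) B ≤ 1 := by
    filter_upwards [hX.ae_posDef t] with ω hω
    have := isProbabilityMeasure_transition hn h hω
    exact prob_le_one
  have key := setIntegral_condExp (μ := P) hm
    ((integrable_const (1 : ℝ)).indicator hms) hA
  rw [setIntegral_congr_ae (g := fun ω => (transition n S F (X t ω) B).toReal) (hm _ hA)
    (((hX.markov t B hB).trans hce.symm).mono fun ω hω _ => hω),
    integral_toReal hTX.aemeasurable (ae_restrict_of_ae (hle.mono fun ω hω =>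
      hω.trans_lt ENNReal.one_lt_top)), setIntegral_indicator hms, setIntegral_const] at key
  rw [Measure.map_apply (hX.measurable _) hB, Measure.restrict_apply hms,
    Measure.bind_apply hB (measurable_transition hn h).aemeasurable,
    lintegral_map hT (hX.measurable t), Set.inter_comm]
  have hfin : ∫⁻ ω in A, transition n S F (X t ω) B ∂P ≠ ∞ :=
    ne_top_of_le_ne_top (b := ∫⁻ _, 1 ∂P) (by simp)
      ((lintegral_mono_ae (ae_restrict_of_ae hle)).trans (setLIntegral_le_lintegral _ _))
  rw [← ENNReal.toReal_eq_toReal_iff' (measure_ne_top _ _) hfin, key]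
  simp [Measure.real]

/-- With `n + 2` degrees of freedom the augmented mean is the scale divided by `n`, so the marginal
mean is `S`. This serves to make the entries of `X t` integrable. -/
theorem IsIWAR.lintegral_quadForm (hX : IsIWAR P n S F X) (hn : 0 < n)
    (h : Admissible S F) (t : ℕ) (w : ι → ℝ) :
    ∫⁻ ω, ENNReal.ofReal (w ⬝ᵥ X t ω *ᵥ w) ∂P = ENNReal.ofReal (w ⬝ᵥ S *ᵥ w) := by
  have hD := posDef_augScale hn h
  have hZ := (hasInvWishartMoments (ι ⊕ ι)) (n + 2) _ hD
  have hZ1 := hZ.1 (by linarith)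
  have h1 := hZ.2 (by linarith) (Sum.elim w 0)
  have hq : Sum.elim w (0 : ι → ℝ) ⬝ᵥ augScale n S F *ᵥ Sum.elim w (0 : ι → ℝ) / (n + 2 - 2) =
      w ⬝ᵥ S *ᵥ w := by
    rw [augScale, smul_mulVec, dotProduct_smul, fromBlocks_mulVec, sumElim_dotProduct_sumElim]
    simp [hn.ne']
  have hkm : Measurable fun M : Matrix (ι ⊕ ι) (ι ⊕ ι) ℝ =>
      invWishartKernel (n + 2) (augScale n S F) M *
        ENNReal.ofReal (Sum.elim w (0 : ι → ℝ) ⬝ᵥ M *ᵥ Sum.elim w (0 : ι → ℝ)) :=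
    (measurable_invWishartKernel _ _).mul (measurable_quadForm _)
  rw [hq, lintegral_symLebesgue_sum _ hkm] at h1
  rw [hX.lintegral_pair t (g := fun p => ENNReal.ofReal (w ⬝ᵥ p.1 *ᵥ w))
    ((measurable_quadForm w).comp measurable_fst)]
  have h2 : ∀ x y : Matrix ι ι ℝ, pairKernel n S F x y * ENNReal.ofReal (w ⬝ᵥ x *ᵥ w) =
      ∫⁻ φ : ι → ι → ℝ, invWishartKernel (n + 2) (augScale n S F) (fromBlocks x (of φ)ᵀ (of φ) y) *
        ENNReal.ofReal (Sum.elim w (0 : ι → ℝ) ⬝ᵥ fromBlocks x (of φ)ᵀ (of φ) y *ᵥ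
          Sum.elim w (0 : ι → ℝ)) := by
    intro x y
    have hquad : ∀ φ : ι → ι → ℝ, Sum.elim w (0 : ι → ℝ) ⬝ᵥ fromBlocks x (of φ)ᵀ (of φ) y *ᵥ
        Sum.elim w (0 : ι → ℝ) = w ⬝ᵥ x *ᵥ w := by
      intro φ
      rw [fromBlocks_mulVec, sumElim_dotProduct_sumElim]
      simp
    simp_rw [hquad]
    rw [lintegral_mul_const' _ _ ENNReal.ofReal_ne_top]
    rfl
  simp_rw [h2]
  rw [h1, ENNReal.mul_div_cancel_right hZ1.1 hZ1.2]

theorem IsIWAR.integral_entries (hX : IsIWAR P n S F X) (hn : 0 < n)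
    (h : Admissible S F) (t : ℕ) (i j : ι) :
    Integrable (fun ω => X t ω i j) P := by
  have hXt := hX.measurable t
  have hm : AEStronglyMeasurable (fun y : Matrix ι ι ℝ => y i j) (P.map (X t)) :=
    (measurable_matrix_apply i j).aestronglyMeasurable
  have h1 := integral_entries_of_quadForm (μ := P.map (X t))
    ((ae_map_iff hXt.aemeasurable measurableSet_posDef).2 (hX.ae_posDef t)) h.1.posSemidef
    (fun w => by rw [lintegral_map (measurable_quadForm w) hXt, hX.lintegral_quadForm hn h]) i j
  exact (integrable_map_measure hm hXt.aemeasurable).1 h1.1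

theorem continuous_meanStep (n : ℝ) (S F : Matrix ι ι ℝ) : Continuous (meanStep n S F) := by
  unfold meanStep
  fun_prop

theorem integrable_meanStep_entries {μ : Measure Ω} [IsFiniteMeasure μ] (n : ℝ) (S F : Matrix ι ι ℝ)
    {Y : Ω → Matrix ι ι ℝ} (hY : ∀ i j, Integrable (fun ω => Y ω i j) μ) (i j : ι) :
    Integrable (fun ω => meanStep n S F (Y ω) i j) μ := by
  simp_rw [meanStep_eq_lin, Matrix.add_apply]
  exact Integrable.add (integral_linear_of_entries (N := of fun i j => ∫ ω, Y ω i j ∂μ)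
    (fun i j => ⟨hY i j, rfl⟩) (entryLinearMap ℝ ℝ i j ∘ₗ meanStepLin n S F)).1
    (integrable_const _)

/-- Two integrals are compared rather than evaluated, so the constant part of `meanStep` cancels
whatever the mass of `μ`; this allows restrictions to events. -/
theorem integral_meanStep_congr {μ : Measure Ω} [IsFiniteMeasure μ] (n : ℝ) (S F : Matrix ι ι ℝ)
    {Y Y' : Ω → Matrix ι ι ℝ} (hY : ∀ i j, Integrable (fun ω => Y ω i j) μ)
    (hY' : ∀ i j, Integrable (fun ω => Y' ω i j) μ)
    (hYY' : ∀ i j, ∫ ω, Y ω i j ∂μ = ∫ ω, Y' ω i j ∂μ) (i j : ι) :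
    ∫ ω, meanStep n S F (Y ω) i j ∂μ = ∫ ω, meanStep n S F (Y' ω) i j ∂μ := by
  set N : Matrix ι ι ℝ := of fun i j => ∫ ω, Y' ω i j ∂μ
  have h1 : Integrable (fun ω => meanStepLin n S F (Y ω) i j) μ ∧
      ∫ ω, meanStepLin n S F (Y ω) i j ∂μ = meanStepLin n S F N i j :=
    integral_linear_of_entries (fun i j => ⟨hY i j, hYY' i j⟩)
      (entryLinearMap ℝ ℝ i j ∘ₗ meanStepLin n S F)
  have h2 : Integrable (fun ω => meanStepLin n S F (Y' ω) i j) μ ∧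
      ∫ ω, meanStepLin n S F (Y' ω) i j ∂μ = meanStepLin n S F N i j :=
    integral_linear_of_entries (fun i j => ⟨hY' i j, rfl⟩)
      (entryLinearMap ℝ ℝ i j ∘ₗ meanStepLin n S F)
  simp_rw [meanStep_eq_lin, Matrix.add_apply]
  rw [integral_add h1.1 (integrable_const _), integral_add h2.1 (integrable_const _), h1.2, h2.2]

/-- On a past event, the one-step mean is integrated against the law of `X t` restricted to that
event. The resulting matrix `N` is semidefinite, so polarization applies to the image law of `X (t +
1)`. -/
theorem IsIWAR.setIntegral_succ [IsProbabilityMeasure P] (hX : IsIWAR P n S F X) (hn : 0 < n)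
    (h : Admissible S F) (t : ℕ) {A : Set Ω}
    (hA : MeasurableSet[⨆ s ≤ t, MeasurableSpace.comap (X s) inferInstance] A) (i j : ι) :
    ∫ ω in A, X (t + 1) ω i j ∂P = ∫ ω in A, meanStep n S F (X t ω) i j ∂P := by
  have hint : ∀ i j, Integrable (fun ω => meanStep n S F (X t ω) i j) (P.restrict A) :=
    integrable_meanStep_entries n S F fun i j => (hX.integral_entries hn h t i j).restrict
  set N : Matrix ι ι ℝ := of fun i j => ∫ ω in A, meanStep n S F (X t ω) i j ∂P with hN
  have hpd : ∀ᵐ ω ∂P.restrict A, (X t ω).PosDef := ae_restrict_of_ae (hX.ae_posDef t)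
  have hquad : ∀ w : ι → ℝ, Integrable (fun ω => w ⬝ᵥ meanStep n S F (X t ω) *ᵥ w) (P.restrict A) ∧
      ∫ ω in A, w ⬝ᵥ meanStep n S F (X t ω) *ᵥ w ∂P = w ⬝ᵥ N *ᵥ w := fun w =>
    integral_linear_of_entries (fun i j => ⟨hint i j, rfl⟩) (quadFormLin w)
  have hnn : ∀ w : ι → ℝ, 0 ≤ᵐ[P.restrict A] fun ω => w ⬝ᵥ meanStep n S F (X t ω) *ᵥ w := fun w => by
    filter_upwards [hpd] with ω hω
    exact quadForm_nonneg (meanStep_posSemidef hn h hω.posSemidef) w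
  have hNpsd : N.PosSemidef := by
    refine PosSemidef.of_dotProduct_mulVec_nonneg ?_ fun w => ?_
    · ext i j
      refine integral_congr_ae ?_
      filter_upwards [hpd] with ω hω
      have hs := (meanStep_posSemidef hn h hω.posSemidef).isHermitian.eq
      exact congrFun (congrFun hs i) j
    · simpa [← (hquad w).2] using integral_nonneg_of_ae (hnn w)
  have hmap := hX.map_restrict hn h t hA
  have hm1 := hX.measurable (t + 1)
  have hae : ∀ᵐ y ∂(P.restrict A).map (X (t + 1)), y.PosDef :=
    (ae_map_iff hm1.aemeasurable measurableSet_posDef).2 (ae_restrict_of_ae (hX.ae_posDef (t + 1)))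
  have hTq : ∀ w : ι → ℝ, Measurable fun x : Matrix ι ι ℝ =>
      ∫⁻ y, ENNReal.ofReal (w ⬝ᵥ y *ᵥ w) ∂transition n S F x := fun w =>
    (Measure.measurable_lintegral (measurable_quadForm w)).comp (measurable_transition hn h)
  have hfin := integral_entries_of_quadForm hae hNpsd (fun w => by
    rw [hmap, Measure.lintegral_bind (measurable_transition hn h).aemeasurable
      (measurable_quadForm w).aemeasurable, lintegral_map (hTq w) (hX.measurable t),
      ← (hquad w).2,
      ofReal_integral_eq_lintegral_ofReal (hquad w).1 (hnn w)]
    refine lintegral_congr_ae ?_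
    filter_upwards [hpd] with ω hω using lintegral_transition_quadForm hn h hω w) i j
  have h2 := hfin.2
  rw [integral_map hm1.aemeasurable (measurable_matrix_apply i j).aestronglyMeasurable] at h2
  exact h2

/-- An event of `X 0` belongs to the past of every `t`, so the one-step identity can be iterated on
it. -/
theorem IsIWAR.setIntegral_iterate [IsProbabilityMeasure P] (hX : IsIWAR P n S F X) (hn : 0 < n)
    (h : Admissible S F) (t : ℕ) :
    (∀ i j, Integrable (fun ω => (meanStep n S F)^[t] (X 0 ω) i j) P) ∧
    ∀ A : Set Ω, MeasurableSet[MeasurableSpace.comap (X 0) inferInstance] A → ∀ i j,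
      ∫ ω in A, X t ω i j ∂P = ∫ ω in A, (meanStep n S F)^[t] (X 0 ω) i j ∂P := by
  induction t with
  | zero => exact ⟨hX.integral_entries hn h 0, fun A _ i j => rfl⟩
  | succ t ih =>
    simp_rw [Function.iterate_succ_apply']
    refine ⟨integrable_meanStep_entries n S F ih.1, fun A hA i j => ?_⟩
    have hle : MeasurableSpace.comap (X 0) inferInstance ≤
        ⨆ s ≤ t, MeasurableSpace.comap (X s) inferInstance :=
      le_iSup₂ (f := fun s (_ : s ≤ t) => MeasurableSpace.comap (X s) inferInstance) 0 t.zero_le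
    rw [hX.setIntegral_succ hn h t (hle _ hA)]
    exact integral_meanStep_congr n S F (fun i j => (hX.integral_entries hn h t i j).restrict)
      (fun i j => (ih.1 i j).restrict) (ih.2 A hA) i j

theorem IsIWAR.condExp_eq_condMean [IsProbabilityMeasure P] (hX : IsIWAR P n S F X) (hn : 0 < n)
    (h : Admissible S F) (t : ℕ) (i j : ι) :
    P[fun ω => X t ω i j | MeasurableSpace.comap (X 0) inferInstance]
      =ᵐ[P] fun ω => condMean n S F t (X 0 ω) i j := by
  obtain ⟨h1, h2⟩ := hX.setIntegral_iterate hn h t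
  have hmeas : Measurable fun x => (meanStep n S F)^[t] x i j :=
    (measurable_matrix_apply i j).comp ((continuous_meanStep n S F).iterate t).measurable
  have h3 : (fun ω => (meanStep n S F)^[t] (X 0 ω) i j) =ᵐ[P]
      P[fun ω => X t ω i j | MeasurableSpace.comap (X 0) inferInstance] :=
    ae_eq_condExp_of_forall_setIntegral_eq (hX.measurable 0).comap_le
      (hX.integral_entries hn h t i j) (fun _ _ _ => (h1 i j).integrableOn)
      (fun A hA _ => (h2 A hA i j).symm)
      (hmeas.comp (comap_measurable (X 0))).aestronglyMeasurable
  refine h3.symm.trans ?_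
  filter_upwards [hX.ae_posDef 0] with ω hω
  rw [condMean_eq_iterate hn h hω]

end ProcessLaw

/-! ### Bounds for the mean recursion, uniform in `n`. -/

section NormBounds

open Matrix
open scoped Matrix.Norms.Operator

theorem sum_abs_apply_le_norm (A : Matrix ι ι ℝ) (i : ι) : ∑ j, |A i j| ≤ ‖A‖ := by
  have h : ∑ j, ‖A i j‖₊ ≤ ‖A‖₊ := by
    rw [linfty_opNNNorm_def]
    exact Finset.le_sup (f := fun i => ∑ j, ‖A i j‖₊) (Finset.mem_univ i)
  have h2 := NNReal.coe_le_coe.2 h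
  rwa [NNReal.coe_sum] at h2

theorem norm_le_of_sum_abs_apply_le (A : Matrix ι ι ℝ) {c : ℝ} (hc : 0 ≤ c)
    (h : ∀ i, ∑ j, |A i j| ≤ c) : ‖A‖ ≤ c := by
  lift c to NNReal using hc
  have h2 : ‖A‖₊ ≤ c := by
    rw [linfty_opNNNorm_def]
    refine Finset.sup_le fun i _ => ?_
    rw [← NNReal.coe_le_coe, NNReal.coe_sum]
    exact h i
  exact NNReal.coe_le_coe.2 h2

theorem abs_apply_le_norm (A : Matrix ι ι ℝ) (i j : ι) : |A i j| ≤ ‖A‖ :=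
  (Finset.single_le_sum (f := fun j => |A i j|) (fun _ _ => abs_nonneg _)
    (Finset.mem_univ j)).trans (sum_abs_apply_le_norm A i)

/-- The row-sum norm is not invariant under transposition; this is one source of the factors `card
ι` in the constants. -/
theorem norm_transpose_le (A : Matrix ι ι ℝ) : ‖Aᵀ‖ ≤ Fintype.card ι * ‖A‖ := by
  refine norm_le_of_sum_abs_apply_le _ (by positivity) fun i => ?_
  calc ∑ j, |Aᵀ i j| ≤ ∑ _j : ι, ‖A‖ := Finset.sum_le_sum fun j _ => abs_apply_le_norm A j i
    _ = Fintype.card ι * ‖A‖ := by simp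

theorem abs_trace_le (A : Matrix ι ι ℝ) : |A.trace| ≤ Fintype.card ι * ‖A‖ :=
  calc |A.trace| ≤ ∑ i, |A i i| := Finset.abs_sum_le_sum_abs _ _
    _ ≤ ∑ _i : ι, ‖A‖ := Finset.sum_le_sum fun i _ => abs_apply_le_norm A i i
    _ = Fintype.card ι * ‖A‖ := by simp

theorem norm_conj_le (F a : Matrix ι ι ℝ) {lam : ℝ} (hF : ‖F‖ ≤ lam) :
    ‖F * a * Fᵀ‖ ≤ Fintype.card ι * lam ^ 2 * ‖a‖ := by
  have h0 : 0 ≤ lam := (norm_nonneg F).trans hF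
  have h1 : ‖Fᵀ‖ ≤ Fintype.card ι * lam :=
    (norm_transpose_le F).trans (by gcongr)
  calc ‖F * a * Fᵀ‖ ≤ ‖F‖ * ‖a‖ * ‖Fᵀ‖ :=
        (norm_mul_le _ _).trans (by gcongr; exact norm_mul_le _ _)
    _ ≤ lam * ‖a‖ * (Fintype.card ι * lam) := by gcongr
    _ = Fintype.card ι * lam ^ 2 * ‖a‖ := by ring

variable {S F : Matrix ι ι ℝ} {lam n : ℝ}

theorem norm_innovation_le (hS : ‖S‖ ≤ lam) (hF : ‖F‖ ≤ lam) :
    ‖S - F * S * Fᵀ‖ ≤ lam + Fintype.card ι * lam ^ 2 * lam :=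
  (norm_sub_le _ _).trans (add_le_add hS ((norm_conj_le F S hF).trans (by gcongr)))

theorem abs_trace_mul_inv_le (hSi : ‖S⁻¹‖ ≤ lam) (a : Matrix ι ι ℝ) :
    |(a * S⁻¹).trace| ≤ Fintype.card ι * lam * ‖a‖ :=
  calc |(a * S⁻¹).trace| ≤ Fintype.card ι * (‖a‖ * ‖S⁻¹‖) :=
        (abs_trace_le _).trans (by gcongr; exact norm_mul_le _ _)
    _ ≤ Fintype.card ι * (‖a‖ * lam) := by gcongr
    _ = Fintype.card ι * lam * ‖a‖ := by ring

theorem abs_trace_div_le (hn : 0 < n) (hSi : ‖S⁻¹‖ ≤ lam) (a : Matrix ι ι ℝ) :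
    |(a * S⁻¹).trace / (n + Fintype.card ι)| ≤ Fintype.card ι * lam * ‖a‖ / n := by
  have h0 : 0 ≤ lam := (norm_nonneg _).trans hSi
  rw [abs_div, abs_of_pos (by positivity : 0 < n + Fintype.card ι)]
  exact div_le_div₀ (by positivity) (abs_trace_mul_inv_le hSi a) hn (by simp)

/-- The factor `card ι` of the trace bound is absorbed by the denominator, so nothing blows up as `n
→ 0` and one constant serves all `n > 0`. -/
theorem abs_trace_div_le_uniform (hn : 0 < n) (hSi : ‖S⁻¹‖ ≤ lam) (a : Matrix ι ι ℝ) :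
    |(a * S⁻¹).trace / (n + Fintype.card ι)| ≤ lam * ‖a‖ := by
  have h0 : 0 ≤ lam := (norm_nonneg _).trans hSi
  have hp : 0 < n + (Fintype.card ι : ℝ) := by positivity
  rw [abs_div, abs_of_pos hp, div_le_iff₀ hp]
  refine (abs_trace_mul_inv_le hSi a).trans ?_
  have : 0 ≤ lam * ‖a‖ * n := by positivity
  linarith

theorem meanStep_eq_add (n : ℝ) (S F a : Matrix ι ι ℝ) :
    meanStep n S F a = F * a * Fᵀ + (n / (n + Fintype.card ι)) • (S - F * S * Fᵀ) +
      ((a * S⁻¹).trace / (n + Fintype.card ι)) • (S - F * S * Fᵀ) := by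
  rw [meanStep, add_div, add_smul, add_assoc]

theorem div_add_card_mem (hn : 0 < n) :
    0 ≤ n / (n + Fintype.card ι) ∧ n / (n + Fintype.card ι) ≤ 1 :=
  ⟨by positivity, (div_le_one (by positivity)).2 (by simp)⟩

/-- One step of the mean recursion grows at most linearly, uniformly in `n`. -/
theorem norm_meanStep_le (hn : 0 < n) (hS : ‖S‖ ≤ lam) (hSi : ‖S⁻¹‖ ≤ lam) (hF : ‖F‖ ≤ lam)
    (a : Matrix ι ι ℝ) :
    ‖meanStep n S F a‖ ≤ Fintype.card ι * lam ^ 2 * ‖a‖ +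
      (1 + lam * ‖a‖) * (lam + Fintype.card ι * lam ^ 2 * lam) := by
  have h0 : 0 ≤ lam := (norm_nonneg S).trans hS
  obtain ⟨hc0, hc1⟩ := div_add_card_mem (ι := ι) hn
  have hV := norm_innovation_le (F := F) hS hF
  rw [meanStep_eq_add]
  refine (norm_add₃_le).trans ?_
  rw [norm_smul, norm_smul, Real.norm_of_nonneg hc0, Real.norm_eq_abs]
  have h1 := norm_conj_le F a hF
  have h2 : n / (n + Fintype.card ι) * ‖S - F * S * Fᵀ‖ ≤
      1 * (lam + Fintype.card ι * lam ^ 2 * lam) := by gcongr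
  have h3 : |(a * S⁻¹).trace / (n + Fintype.card ι)| * ‖S - F * S * Fᵀ‖ ≤
      lam * ‖a‖ * (lam + Fintype.card ι * lam ^ 2 * lam) := by
    gcongr
    exact abs_trace_div_le_uniform hn hSi a
  linarith

theorem exists_norm_iterate_meanStep_le (ι : Type*) [Fintype ι] [DecidableEq ι] (t : ℕ)
    {lam : ℝ} (h0 : 0 ≤ lam) : ∃ C : ℝ, 0 ≤ C ∧
    ∀ S F : Matrix ι ι ℝ, ‖S‖ ≤ lam → ‖S⁻¹‖ ≤ lam → ‖F‖ ≤ lam → ∀ (n : ℝ) (x : Matrix ι ι ℝ),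
      0 < n → ‖(meanStep n S F)^[t] x‖ ≤ C * (1 + ‖x‖) := by
  induction t with
  | zero => exact ⟨1, zero_le_one, fun S F _ _ _ n x _ => by simp⟩
  | succ t ih =>
    obtain ⟨C, hC, ih⟩ := ih
    set v := lam + Fintype.card ι * lam ^ 2 * lam with hv
    have hv0 : 0 ≤ v := by positivity
    refine ⟨Fintype.card ι * lam ^ 2 * C + (1 + lam * C) * v, by positivity,
      fun S F hS hSi hF n x hn => ?_⟩
    rw [Function.iterate_succ_apply']
    refine (norm_meanStep_le hn hS hSi hF _).trans ?_
    rw [← hv]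
    have h1 := ih S F hS hSi hF n x hn
    calc Fintype.card ι * lam ^ 2 * ‖(meanStep n S F)^[t] x‖ +
          (1 + lam * ‖(meanStep n S F)^[t] x‖) * v
        ≤ Fintype.card ι * lam ^ 2 * (C * (1 + ‖x‖)) +
          ((1 + ‖x‖) + lam * (C * (1 + ‖x‖))) * v := by
          gcongr
          linarith [norm_nonneg x]
      _ = _ := by ring

/-- The leading term of the expansion of the conditional mean in powers of `1 / n`. -/
def meanLeading (n : ℝ) (S F : Matrix ι ι ℝ) (t : ℕ) (x : Matrix ι ι ℝ) : Matrix ι ι ℝ :=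
  F ^ t * x * Fᵀ ^ t + (n / (n + Fintype.card ι)) • (S - F ^ t * S * Fᵀ ^ t)

/-- `meanLeading` solves the recursion with the trace term removed, so the error is conjugated by
`F` and receives one trace term per step. -/
theorem meanStep_sub_meanLeading_succ (n : ℝ) (S F : Matrix ι ι ℝ) (t : ℕ)
    (a x : Matrix ι ι ℝ) :
    meanStep n S F a - meanLeading n S F (t + 1) x =
      F * (a - meanLeading n S F t x) * Fᵀ +
        ((a * S⁻¹).trace / (n + Fintype.card ι)) • (S - F * S * Fᵀ) := by
  have h (y : Matrix ι ι ℝ) : F ^ (t + 1) * y * Fᵀ ^ (t + 1) = F * (F ^ t * y * Fᵀ ^ t) * Fᵀ := by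
    rw [pow_succ', pow_succ Fᵀ]
    simp only [Matrix.mul_assoc]
  rw [meanStep_eq_add, meanLeading, meanLeading, h, h]
  simp only [Matrix.mul_sub, Matrix.sub_mul, Matrix.mul_add, Matrix.add_mul, Matrix.mul_smul,
    Matrix.smul_mul, smul_sub]
  abel

theorem exists_norm_iterate_sub_meanLeading_le (ι : Type*) [Fintype ι] [DecidableEq ι] (t : ℕ)
    {lam : ℝ} (h0 : 0 ≤ lam) : ∃ C : ℝ, 0 ≤ C ∧
    ∀ S F : Matrix ι ι ℝ, ‖S‖ ≤ lam → ‖S⁻¹‖ ≤ lam → ‖F‖ ≤ lam → ∀ (n : ℝ) (x : Matrix ι ι ℝ),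
      0 < n → ‖(meanStep n S F)^[t] x - meanLeading n S F t x‖ ≤ C * (1 + ‖x‖) / n := by
  induction t with
  | zero => exact ⟨0, le_rfl, fun S F _ _ _ n x _ => by simp [meanLeading]⟩
  | succ t ih =>
    obtain ⟨D, hD, ih⟩ := ih
    obtain ⟨C, hC, hb⟩ := exists_norm_iterate_meanStep_le ι t h0
    set v := lam + Fintype.card ι * lam ^ 2 * lam with hv
    have hv0 : 0 ≤ v := by positivity
    -- The first summand propagates the previous error `D`; the second bounds the new trace term,
    -- with `C` bounding the iterate and `v` the innovation `V`.
    refine ⟨Fintype.card ι * lam ^ 2 * D + Fintype.card ι * lam * C * v, by positivity,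
      fun S F hS hSi hF n x hn => ?_⟩
    rw [Function.iterate_succ_apply', meanStep_sub_meanLeading_succ]
    refine (norm_add_le _ _).trans ?_
    rw [norm_smul, Real.norm_eq_abs]
    have h1 := norm_conj_le F ((meanStep n S F)^[t] x - meanLeading n S F t x) hF
    have h2 := abs_trace_div_le hn hSi ((meanStep n S F)^[t] x)
    calc _ ≤ Fintype.card ι * lam ^ 2 * (D * (1 + ‖x‖) / n) +
          Fintype.card ι * lam * (C * (1 + ‖x‖)) / n * v := by
          refine add_le_add (h1.trans ?_) (mul_le_mul (h2.trans ?_)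
            (norm_innovation_le hS hF) (norm_nonneg _) (by positivity))
          · gcongr
            exact ih S F hS hSi hF n x hn
          · gcongr
            exact hb S F hS hSi hF n x hn
      _ = _ := by ring

end NormBounds

/-! ### Expansion, limit and exponential forgetting. -/

section Limit

open Matrix

/-- Expansion of the conditional mean, with a remainder of order `1 / n`. -/
theorem exists_abs_condMean_sub_meanLeading_le (ι : Type*) [Fintype ι] [DecidableEq ι] (t : ℕ)
    (lam : ℝ) : ∃ C : ℝ, ∀ S F : Matrix ι ι ℝ, Admissible S F →
    inftyNorm S ≤ lam → inftyNorm S⁻¹ ≤ lam → inftyNorm F ≤ lam →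
    ∀ (n : ℝ) (x : Matrix ι ι ℝ), 0 < n → x.PosDef → ∀ i j,
      |(condMean n S F t x - meanLeading n S F t x) i j| ≤ C * (1 + inftyNorm x) / n := by
  open scoped Matrix.Norms.Operator in
  -- For negative `lam` no `S` satisfies the norm bound.
  obtain h0 | h0 := lt_or_ge lam 0
  · exact ⟨0, fun S F _ hS => absurd ((norm_nonneg S).trans hS) h0.not_ge⟩
  · obtain ⟨C, -, hC⟩ := exists_norm_iterate_sub_meanLeading_le ι t h0
    refine ⟨C, fun S F h hS hSi hF n x hn hx i j => ?_⟩
    rw [condMean_eq_iterate hn h hx]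
    exact (abs_apply_le_norm _ i j).trans (hC S F hS hSi hF n x hn)

theorem tendsto_meanLeading (S F : Matrix ι ι ℝ) (t : ℕ) (x : Matrix ι ι ℝ) :
    Tendsto (fun n : ℝ => meanLeading n S F t x) atTop (𝓝 (S + F ^ t * (x - S) * Fᵀ ^ t)) := by
  have hc : Tendsto (fun n : ℝ => n / (n + Fintype.card ι)) atTop (𝓝 1) := by
    have h1 : Tendsto (fun n : ℝ => 1 - Fintype.card ι / (n + Fintype.card ι)) atTop
        (𝓝 (1 - 0)) :=
      tendsto_const_nhds.sub (tendsto_const_nhds.div_atTop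
        (tendsto_atTop_add_const_right _ _ tendsto_id))
    rw [sub_zero] at h1
    refine h1.congr' ?_
    filter_upwards [eventually_gt_atTop 0] with n hn
    have : n + (Fintype.card ι : ℝ) ≠ 0 := by positivity
    field_simp
    ring
  have h := (hc.smul_const (S - F ^ t * S * Fᵀ ^ t)).const_add (F ^ t * x * Fᵀ ^ t)
  convert! h using 2
  rw [one_smul, Matrix.mul_sub, Matrix.sub_mul]
  abel

/-- The limit of the conditional mean as the degrees of freedom grow. -/
theorem tendsto_condMean {S F : Matrix ι ι ℝ} (h : Admissible S F) (t : ℕ) {x : Matrix ι ι ℝ}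
    (hx : x.PosDef) :
    Tendsto (fun n : ℝ => condMean n S F t x) atTop (𝓝 (S + F ^ t * (x - S) * Fᵀ ^ t)) := by
  obtain ⟨C, hC⟩ := exists_abs_condMean_sub_meanLeading_le ι t
    (max (inftyNorm S) (max (inftyNorm S⁻¹) (inftyNorm F)))
  have hR : Tendsto (fun n : ℝ => condMean n S F t x - meanLeading n S F t x) atTop (𝓝 0) := by
    refine tendsto_pi_nhds.2 fun i => tendsto_pi_nhds.2 fun j => ?_
    refine squeeze_zero_norm' ?_ (tendsto_const_nhds.div_atTop tendsto_id :
      Tendsto (fun n : ℝ => C * (1 + inftyNorm x) / n) atTop (𝓝 0))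
    filter_upwards [eventually_gt_atTop 0] with n hn
    exact hC S F h (le_max_left _ _) (le_max_of_le_right (le_max_left _ _))
      (le_max_of_le_right (le_max_right _ _)) n x hn hx i j
  simpa using hR.add (tendsto_meanLeading S F t x)

/-- By Gelfand's formula `‖a ^ t‖ ≤ r ^ t` for large `t`; the constant `K` absorbs the finitely many
other exponents. -/
theorem exists_norm_pow_le_of_spectralRadius_lt {A : Type*} [NormedRing A] [NormedAlgebra ℂ A]
    [CompleteSpace A] (a : A) {r : ℝ} (hr : spectralRadius ℂ a < ENNReal.ofReal r) :
    ∃ K : ℝ, 0 ≤ K ∧ ∀ t : ℕ, ‖a ^ t‖ ≤ K * r ^ t := by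
  have hr0 : 0 < r := ENNReal.ofReal_pos.1 (bot_le.trans_lt hr)
  have hev : ∀ᶠ t : ℕ in atTop, ‖a ^ t‖ / r ^ t ≤ 1 := by
    filter_upwards [(spectrum.pow_norm_pow_one_div_tendsto_nhds_spectralRadius a).eventually_lt_const
      hr, eventually_gt_atTop 0] with t ht ht0
    have h1 := ((ENNReal.ofReal_lt_ofReal_iff hr0).1 ht).le
    rw [div_le_one (by positivity)]
    calc ‖a ^ t‖ = (‖a ^ t‖ ^ (1 / t : ℝ)) ^ t := by
          rw [one_div, Real.rpow_inv_natCast_pow (norm_nonneg _) ht0.ne']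
      _ ≤ r ^ t := by gcongr
  obtain ⟨K, hK⟩ := (show IsBoundedUnder (· ≤ ·) atTop fun t : ℕ => ‖a ^ t‖ / r ^ t from
    ⟨1, eventually_map.2 hev⟩).bddAbove_range
  have hle (t : ℕ) : ‖a ^ t‖ / r ^ t ≤ K := hK ⟨t, rfl⟩
  refine ⟨K, le_trans (by positivity) (hle 0), fun t => ?_⟩
  exact (div_le_iff₀ (by positivity)).1 (hle t)

-- Gelfand's formula needs complex scalars; the entrywise embedding into complex matrices commutes
-- with powers and preserves the row-sum norm.
open scoped Matrix.Norms.Operator in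
theorem exists_norm_pow_le_of_specRadius_lt (F : Matrix ι ι ℝ) {r : ℝ}
    (hr : specRadius F < ENNReal.ofReal r) :
    ∃ K : ℝ, 0 ≤ K ∧ ∀ t : ℕ, ‖F ^ t‖ ≤ K * r ^ t := by
  obtain ⟨K, hK, h⟩ := exists_norm_pow_le_of_spectralRadius_lt (F.map (algebraMap ℝ ℂ)) hr
  refine ⟨K, hK, fun t => ?_⟩
  convert! h t using 1
  rw [← Matrix.map_pow, linfty_opNorm_def, linfty_opNorm_def]
  simp [nnnorm]

/-- Exponential forgetting of the initial state by the limiting conditional mean. -/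
theorem exists_inftyNorm_limit_sub_le {S F : Matrix ι ι ℝ} (h : Admissible S F) {r : ℝ}
    (hr : specRadius F < ENNReal.ofReal r) :
    ∃ K : ℝ, ∀ (t : ℕ) (x L : Matrix ι ι ℝ), x.PosDef →
      Tendsto (fun n : ℝ => condMean n S F t x) atTop (𝓝 L) →
      inftyNorm (L - S) ≤ K * r ^ (2 * t) * inftyNorm (x - S) := by
  open scoped Matrix.Norms.Operator in
  obtain ⟨K, hK, hF⟩ := exists_norm_pow_le_of_specRadius_lt F hr
  have hr0 : 0 < r := ENNReal.ofReal_pos.1 (bot_le.trans_lt hr)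
  -- One factor `K r ^ t` comes from `F ^ t` and another, times `card ι`, from its transpose.
  refine ⟨K * (Fintype.card ι * K), fun t x L hx hL => ?_⟩
  rw [tendsto_nhds_unique hL (tendsto_condMean h t hx), add_sub_cancel_left, ← transpose_pow]
  have hT : ‖(F ^ t)ᵀ‖ ≤ Fintype.card ι * (K * r ^ t) :=
    (norm_transpose_le _).trans (by gcongr; exact hF t)
  calc ‖F ^ t * (x - S) * (F ^ t)ᵀ‖ ≤ ‖F ^ t‖ * ‖x - S‖ * ‖(F ^ t)ᵀ‖ :=
        (norm_mul_le _ _).trans (by gcongr; exact norm_mul_le _ _)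
    _ ≤ (K * r ^ t) * ‖x - S‖ * (Fintype.card ι * (K * r ^ t)) := by
        gcongr
        exact hF t
    _ = K * (Fintype.card ι * K) * r ^ (2 * t) * ‖x - S‖ := by ring

end Limit

end IWAR

end

/-! ### The theorem. -/

theorem theorem5 (q : ℕ) :
    -- The conditional mean of every process of the class, started from any admissible state,
    -- is well defined, and `condMean` is a version of the conditional expectation.
    (∀ (n : ℝ) (S F : Matrix (Fin q) (Fin q) ℝ), 0 < n → IWAR.Admissible S F → ∀ t : ℕ,
      (∀ x : Matrix (Fin q) (Fin q) ℝ, x.PosDef →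
        IsProbabilityMeasure (IWAR.lawAt n S F t x) ∧
        ∀ i j, Integrable (fun y : Matrix (Fin q) (Fin q) ℝ => y i j) (IWAR.lawAt n S F t x)) ∧
      (∀ (Ω : Type*) [MeasurableSpace Ω] (P : Measure Ω) [IsProbabilityMeasure P]
        (X : ℕ → Ω → Matrix (Fin q) (Fin q) ℝ), IWAR.IsIWAR P n S F X →
        (∀ᵐ ω ∂P, (X 0 ω).PosDef) ∧
        ∀ i j, Integrable (fun ω => X t ω i j) P ∧
          P[fun ω => X t ω i j | MeasurableSpace.comap (X 0) inferInstance]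
            =ᵐ[P] fun ω => IWAR.condMean n S F t (X 0 ω) i j)) ∧
    -- Expansion with an entrywise remainder of order `1/n`.
    (∀ (t : ℕ) (lam : ℝ), ∃ C : ℝ, ∀ (S F : Matrix (Fin q) (Fin q) ℝ), IWAR.Admissible S F →
      IWAR.inftyNorm S ≤ lam → IWAR.inftyNorm S⁻¹ ≤ lam → IWAR.inftyNorm F ≤ lam →
      ∀ (n : ℝ) (x : Matrix (Fin q) (Fin q) ℝ), 0 < n → x.PosDef → ∀ i j,
        |(IWAR.condMean n S F t x - (F ^ t * x * F.transpose ^ t +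
            (n / (n + q)) • (S - F ^ t * S * F.transpose ^ t))) i j|
          ≤ C * (1 + IWAR.inftyNorm x) / n) ∧
    -- Limit as `n → ∞`.
    (∀ (S F : Matrix (Fin q) (Fin q) ℝ), IWAR.Admissible S F →
      ∀ (t : ℕ) (x : Matrix (Fin q) (Fin q) ℝ), x.PosDef →
        Tendsto (fun n : ℝ => IWAR.condMean n S F t x) atTop
          (𝓝 (S + F ^ t * (x - S) * F.transpose ^ t))) ∧
    -- Exponential forgetting of the initial state by the limiting conditional mean.
    (∀ (S F : Matrix (Fin q) (Fin q) ℝ), IWAR.Admissible S F → IWAR.specRadius F < 1 →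
      ∀ r : ℝ, IWAR.specRadius F < ENNReal.ofReal r →
        ∃ K : ℝ, ∀ (t : ℕ) (x L : Matrix (Fin q) (Fin q) ℝ), x.PosDef →
          Tendsto (fun n : ℝ => IWAR.condMean n S F t x) atTop (𝓝 L) →
          IWAR.inftyNorm (L - S) ≤ K * r ^ (2 * t) * IWAR.inftyNorm (x - S)) := by
  refine ⟨fun n S F hn h t => ⟨fun x hx => ⟨(IWAR.lawAt_spec hn h hx t).1,
      IWAR.integrable_entry_lawAt hn h hx t⟩, fun Ω _ P _ X hX => ⟨hX.ae_posDef 0, fun i j =>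
      ⟨hX.integral_entries hn h t i j, hX.condExp_eq_condMean hn h t i j⟩⟩⟩,
    fun t lam => ?_, fun S F h t x hx => IWAR.tendsto_condMean h t hx,
    fun S F h _ r hr => IWAR.exists_inftyNorm_limit_sub_le h hr⟩
  simpa only [IWAR.meanLeading, Fintype.card_fin] using
    IWAR.exists_abs_condMean_sub_meanLeading_le (Fin q) t lam
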